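/- Let $T>0$, $I=(0,T)$, let $\Lambda_d=\prod_{i=1}^d(a_i,b_i)$ with $a_i<b_i$, and $\Omega=I\times\Lambda_d$. Let either $0<2\tau^{min}<2\tau^{max}<1$ or $1<2\tau^{min}<2\tau^{max}<2$, and let $\varphi\in L^1([\tau^{min},\tau^{max}])$ with $\varphi>0$. Let $H=\mathbb R$ or $H=L^2(\Lambda_d)$, so that $L^2(I;H)$ is $L^2(I)$ or $L^2(\Omega)$, and write $(\cdot,\cdot)$ for its inner product. For $\sigma>0$, $\sigma\notin\mathbb N$, $n=\lceil\sigma\rceil$, let $${}_0D_t^\sigma u=\frac{d^n}{dt^n}\,\frac1{\Gamma(n-\sigma)}\int_0^t\frac{u(s)\,ds}{(t-s)^{\sigma+1-n}},\qquad {}_tD_T^\sigma u=(-1)^n\frac{d^n}{dt^n}\,\frac1{\Gamma(n-\sigma)}\int_t^T\frac{u(s)\,ds}{(s-t)^{\sigma+1-n}}$$ be the Riemann–Liouville derivatives, with $d^n/dt^n$ in the sense of distributions on $I$. Let ${}^{l,\mathfrak D}H^\varphi(I;H)$ be the space of all $u\in L^2(I;H)$ such that ${}_0D_t^\tau u\in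 L^2(I;H)$ for almost every $\tau\in[\tau^{min},\tau^{max}]$ and $\int_{\tau^{min}}^{\tau^{max}}\varphi(\tau)\,\|{}_0D_t^\tau u\|_{L^2(I;H)}^2\,d\tau<\infty$. (No initial condition at $t=0$ and no boundary condition in $x$ is required; functions that satisfy such conditions are included.) Let $u,v\in{}^{l,\mathfrak D}H^\varphi(I;H)$ and, if $1<2\tau^{min}$, let in addition $v|_{t=T}=0$, that is, $\|v(t)\|_H\to0$ as $t\to T^-$ outside a null set. For $\tau\in[\tau^{min},\tau^{max}]$ let $({}_0D_t^{2\tau}u,v)$ be the value at $v$ of the distribution ${}_0D_t^{2\tau}u$, extended by continuity from the smooth compactly supported functions $\psi:I\to H$ with respect to the norm $(\|\psi\|_{L^2(I;H)}^2+\|{}_0D_t^\tau\psi\|_{L^2(I;H)}^2)^{1/2}$. Then, for almost every $\tau\in[\tau^{min},\tau^{max}]$, this pairing is well defined ($v$ is in the closure of the test functions and the limit exists), it is the ordinary inner product whenever ${}_0D_t^{2\tau}u\in L^2(I;H)$, and ${}_tD_T^\tau v\in L^2(I;H)$. Moreover, both integrals below converge absolutely and $$\int_{\tau^{min}}^{\tau^{max}}\varphi(\tau)\,\big({}_0D_t^{2\tau}u,v\big)\,d\tau=\int_{\tau^{min}}^{\tau^{max}}\varphi(\tau)\,\big({}_0D_t^{\tau}u,{}_tD_T^{\tau}v\big)\,d\tau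 .$$ This holds both on $I$ ($H=\mathbb R$) and on $\Omega$ ($H=L^2(\Lambda_d)$). -/

import Mathlib

open MeasureTheory Set Filter Topology
open scoped ContDiff

noncomputable section

namespace FracSobolev

/-! Functions on the time interval `I = (0, T)` with values in a real Hilbert space `H`.
The choice `H = ℝ` gives functions on `I`; the choice `H = L²(Λ)` gives functions on `I × Λ`,
through `L²(I × Λ) = L²(I; L²(Λ))`. -/

variable {H : Type*} [NormedAddCommGroup H] [InnerProductSpace ℝ H]

/-- Lebesgue measure on `I = (0, T)`. -/
def timeMeasure (T : ℝ) : Measure ℝ := volume.restrict (Ioo 0 T)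

/-- The inner product `(f, g)` of `L²(I; H)`. For `H = ℝ` it is `∫_I f g`, for `H = L²(Λ)` it is
`∫_{I × Λ} f g`. -/
def ip (T : ℝ) (f g : ℝ → H) : ℝ := ∫ t, inner ℝ (f t) (g t) ∂(timeMeasure T)

/-- Left Riemann-Liouville integral of order `σ > 0`:
`Γ(σ)⁻¹ ∫_0^t (t - s)^(σ - 1) u(s) ds`. -/
def rlIntLeft (σ : ℝ) (u : ℝ → H) (t : ℝ) : H :=
  (Real.Gamma σ)⁻¹ • ∫ s in (0 : ℝ)..t, (t - s) ^ (σ - 1) • u s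

/-- Right Riemann-Liouville integral of order `σ > 0`:
`Γ(σ)⁻¹ ∫_t^T (s - t)^(σ - 1) u(s) ds`. -/
def rlIntRight (T σ : ℝ) (u : ℝ → H) (t : ℝ) : H :=
  (Real.Gamma σ)⁻¹ • ∫ s in t..T, (s - t) ^ (σ - 1) • u s

/-- The test functions `C_0^∞(I; H)`: smooth, with compact support inside `(0, T)`. -/
def IsTest (T : ℝ) (ψ : ℝ → H) : Prop :=
  ContDiff ℝ ∞ ψ ∧ HasCompactSupport ψ ∧ tsupport ψ ⊆ Ioo 0 T

/-- The left Riemann-Liouville derivative `(d/dt)^n ₀I_t^{n-σ} u`, `n = ⌈σ⌉`, as a distribution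
on `I`, evaluated at the test function `ψ`: the `n` derivatives are moved to `ψ`, with the
sign `(-1)^n`. -/
def rlDistLeft (T σ : ℝ) (u ψ : ℝ → H) : ℝ :=
  (-1) ^ ⌈σ⌉₊ * ip T (rlIntLeft ((⌈σ⌉₊ : ℝ) - σ) u) (iteratedDeriv ⌈σ⌉₊ ψ)

/-- The right Riemann-Liouville derivative `(-1)^n (d/dt)^n ₜI_T^{n-σ} u`, `n = ⌈σ⌉`, as a
distribution on `I`; the two signs `(-1)^n` cancel. -/
def rlDistRight (T σ : ℝ) (u ψ : ℝ → H) : ℝ :=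
  ip T (rlIntRight T ((⌈σ⌉₊ : ℝ) - σ) u) (iteratedDeriv ⌈σ⌉₊ ψ)

/-- `g ∈ L²(I; H)` is the left derivative `₀D_t^σ u` (weak derivative of the Riemann-Liouville
integral). -/
def HasLeftDeriv (T σ : ℝ) (u g : ℝ → H) : Prop :=
  MemLp g 2 (timeMeasure T) ∧ ∀ ψ : ℝ → H, IsTest T ψ → ip T g ψ = rlDistLeft T σ u ψ

/-- `g ∈ L²(I; H)` is the right derivative `ₜD_T^σ u`. -/
def HasRightDeriv (T σ : ℝ) (u g : ℝ → H) : Prop :=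
  MemLp g 2 (timeMeasure T) ∧ ∀ ψ : ℝ → H, IsTest T ψ → ip T g ψ = rlDistRight T σ u ψ

open Classical in
/-- `₀D_t^σ u` when it is in `L²(I; H)` (it is then unique almost everywhere), `0` otherwise. -/
def leftDeriv (T σ : ℝ) (u : ℝ → H) : ℝ → H :=
  if h : ∃ g, HasLeftDeriv T σ u g then h.choose else 0

open Classical in
/-- `ₜD_T^σ u` when it is in `L²(I; H)` (it is then unique almost everywhere), `0` otherwise. -/
def rightDeriv (T σ : ℝ) (u : ℝ → H) : ℝ → H :=
  if h : ∃ g, HasRightDeriv T σ u g then h.choose else 0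

/-- The left distributed Sobolev space: `u ∈ L²(I; H)` with `₀D_t^τ u ∈ L²(I; H)` for almost every
`τ` and `∫ φ(τ) ‖₀D_t^τ u‖² dτ < ∞`. -/
def MemLeftDistributed (T τmin τmax : ℝ) (φ : ℝ → ℝ) (u : ℝ → H) : Prop :=
  MemLp u 2 (timeMeasure T) ∧
  (∀ᵐ τ ∂(volume.restrict (Icc τmin τmax)), ∃ g, HasLeftDeriv T τ u g) ∧
  IntegrableOn (fun τ => φ τ * ∫ t, ‖leftDeriv T τ u t‖ ^ 2 ∂(timeMeasure T)) (Icc τmin τmax)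

/-- The distance `(‖ψ - v‖² + ‖₀D_t^τ ψ - ₀D_t^τ v‖²)^(1/2)` of the left Sobolev space of order
`τ`, for `ψ` and `v` that have a derivative `₀D_t^τ` in `L²(I; H)`. -/
def leftDist (T τ : ℝ) (ψ v : ℝ → H) : ENNReal :=
  (eLpNorm (ψ - v) 2 (timeMeasure T) ^ 2 +
    eLpNorm (leftDeriv T τ ψ - leftDeriv T τ v) 2 (timeMeasure T) ^ 2) ^ (1 / 2 : ℝ)

/-- Convergence of test functions to `v` in the left Sobolev norm of order `τ`. -/
def testNhds (T τ : ℝ) (v : ℝ → H) : Filter (ℝ → H) :=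
  comap (fun ψ => leftDist T τ ψ v) (𝓝 0) ⊓ 𝓟 {ψ | IsTest T ψ}

/-- `(F, v) = ℓ` for a distribution `F` on `I` and `v` in the left Sobolev space of order `τ`:
`v` is in the closure of the test functions, and `F(ψ)` tends to `ℓ` as the test function `ψ`
tends to `v` in the norm of that space. So `ℓ` is the value at `v` of the extension of `F` by
continuity. -/
def HasDualPairing (T τ : ℝ) (F : (ℝ → H) → ℝ) (v : ℝ → H) (ℓ : ℝ) : Prop :=
  (∃ g, HasLeftDeriv T τ v g) ∧ (testNhds T τ v).NeBot ∧ Tendsto F (testNhds T τ v) (𝓝 ℓ)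

open Classical in
/-- The pairing `(₀D_t^{2τ} u, v)` for `u`, `v` in the left Sobolev space of order `τ`. -/
def dualPairing (T τ : ℝ) (u v : ℝ → H) : ℝ :=
  if h : ∃ ℓ, HasDualPairing T τ (rlDistLeft T (2 * τ) u) v ℓ then h.choose else 0

/-- `v|_{t=T} = 0`: `v(t)` tends to `0` as `t` increases to `T`, up to a null set of times. -/
def ZeroAtEnd (T : ℝ) (v : ℝ → H) : Prop :=
  Tendsto v (𝓝[<] T ⊓ ae volume) (𝓝 0)

/-- Distributed-order fractional integration by parts for `u` and `v`. The pairing on the left and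
the derivative `ₜD_T^τ v` on the right exist, the pairing is the ordinary inner product whenever
`₀D_t^{2τ} u` is in `L²`, both integrals over `τ` converge absolutely, and they agree. -/
def IntegrationByParts (T τmin τmax : ℝ) (φ : ℝ → ℝ) (u v : ℝ → H) : Prop :=
  (∀ᵐ τ ∂(volume.restrict (Icc τmin τmax)),
    (∃ ℓ, HasDualPairing T τ (rlDistLeft T (2 * τ) u) v ℓ) ∧
    (∀ f, HasLeftDeriv T (2 * τ) u f → dualPairing T τ u v = ip T f v) ∧
    ∃ h, HasRightDeriv T τ v h) ∧
  IntegrableOn (fun τ => φ τ * dualPairing T τ u v) (Icc τmin τmax) ∧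
  IntegrableOn (fun τ => φ τ * ip T (leftDeriv T τ u) (rightDeriv T τ v)) (Icc τmin τmax) ∧
  ∫ τ in Icc τmin τmax, φ τ * dualPairing T τ u v =
    ∫ τ in Icc τmin τmax, φ τ * ip T (leftDeriv T τ u) (rightDeriv T τ v)

/-- The open box `Λ_d = ∏ (a_i, b_i)`. -/
def box {d : ℕ} (a b : Fin d → ℝ) : Set (Fin d → ℝ) := Set.pi univ fun i => Ioo (a i) (b i)

/-- `L²(Λ_d)`. -/
abbrev L2Box {d : ℕ} (a b : Fin d → ℝ) : Type := Lp ℝ 2 (volume.restrict (box a b))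

end FracSobolev

end

noncomputable section

namespace FracSobolev

/-! ### Convolution operators on `L²(I; H)` with an integrable kernel -/

section Kernel

variable {H : Type*} [NormedAddCommGroup H] [InnerProductSpace ℝ H]

/-! Write J^σ for the left Riemann-Liouville integral (`fracInt T σ`) and J*^σ for its adjoint in
L²(I; H), the right one (`fracIntRight T σ`). Both are semigroups in σ > 0, by Euler's beta
integral.

Representation (`ae_eq_fracInt`). If G is the derivative of u of order τ, du Bois-Reymond's lemma
gives J^{1-τ} u = J^1 G + c, hence J^1 u = J^{τ+1} G + J^τ c. The left side does not depend on τ, so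
two orders can be compared near t = 0. There J^τ c is a multiple of t^τ, which dominates every term
of higher order; so c = 0 for the smaller order, and u = J^τ G. This is why no initial condition is
needed: the singular part c t^{τ-1} cannot survive at a larger order.

Comparison (`cos_mul_norm_fracIntRight_le`, `IsTest.norm_rightD_le`). For a < 1/2 one has cos(πa)
‖J*^a f‖² ≤ (J^{2a} f, f) = (J^a f, J*^a f). The norm on I is at most the norm on the whole line,
which is an explicit quadratic form; the reflection formula identifies the constant. Hence, for τ ≠
1/2, the right derivative of a test function is bounded by its left derivative, with factor 1/|cos
πτ|.

Density (`mem_closure_testLeftD`). A vector k orthogonal to the left derivatives of all test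
functions satisfies J*^1 k = J*^τ c for a constant c. If τ < 1/2, the size of both sides at T forces
c = 0. If τ > 1/2, then k = (T - t)^{τ-1} c / Γ(τ), and the inner product of k with the derivative
of v is the inner product of c with v(T) = 0.

Conclusion. For a test function ψ the distribution of order 2τ takes the value (G, right derivative
of ψ). When ψ → v in the left norm, the comparison makes the right derivatives converge, and their
limit is the right derivative ρ of v. So the pairing equals (G, ρ) for almost every τ, and the two
integrands agree. Integrability over τ follows from |(G, ρ)| ≤ ‖G‖ ‖ρ‖, a positive lower bound for
|cos πτ| on [τmin, τmax], and measurability, which is obtained weakly and transferred to the product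
through a countable Hilbert basis. -/

instance isFiniteMeasure_timeMeasure (T : ℝ) : IsFiniteMeasure (timeMeasure T) := by
  unfold timeMeasure; infer_instance

theorem timeMeasure_le (T : ℝ) : timeMeasure T ≤ volume := Measure.restrict_le_self

/-- The bilinear form of the convolution operator with kernel `k` on `L²(I; H)`. -/
def kernelForm (T : ℝ) (k : ℝ → ℝ) (f g : ℝ → H) : ℝ :=
  ∫ p : ℝ × ℝ, k (p.2 - p.1) * inner ℝ (f p.1) (g p.2) ∂((timeMeasure T).prod (timeMeasure T))

theorem integrable_kernel_mul_fst {T : ℝ} {k w : ℝ → ℝ} (hk : Integrable k)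
    (hw : Integrable w (timeMeasure T)) :
    Integrable (fun p : ℝ × ℝ => k (p.2 - p.1) * w p.1)
      ((timeMeasure T).prod (timeMeasure T)) := by
  have h := (hw.convolution_integrand (ContinuousLinearMap.mul ℝ ℝ) hk).swap
  have h2 := h.mono_measure (ν := (timeMeasure T).prod volume) le_rfl
  refine (h2.mono_measure (Measure.prod_mono le_rfl (timeMeasure_le T))).congr ?_
  exact Eventually.of_forall fun p => by simp [mul_comm]

theorem integrable_kernel_mul_snd {T : ℝ} {k w : ℝ → ℝ} (hk : Integrable k)
    (hw : Integrable w (timeMeasure T)) :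
    Integrable (fun p : ℝ × ℝ => k (p.2 - p.1) * w p.2)
      ((timeMeasure T).prod (timeMeasure T)) := by
  have h := (integrable_kernel_mul_fst (hk.comp_neg) hw).swap
  refine h.congr (Eventually.of_forall fun p => by simp)

theorem aestronglyMeasurable_comp_sub {T : ℝ} {k : ℝ → ℝ} (hk : AEStronglyMeasurable k volume) :
    AEStronglyMeasurable (fun p : ℝ × ℝ => k (p.2 - p.1))
      ((timeMeasure T).prod (timeMeasure T)) := by
  have h : AEStronglyMeasurable (fun p : ℝ × ℝ => k (p.2 - p.1)) (volume.prod volume) :=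
    (hk.comp_quasiMeasurePreserving (quasiMeasurePreserving_sub volume volume)).prod_swap
  exact h.mono_measure (Measure.prod_mono (timeMeasure_le T) (timeMeasure_le T))

theorem aestronglyMeasurable_inner_prod {T : ℝ} {f g : ℝ → H}
    (hf : AEStronglyMeasurable f (timeMeasure T)) (hg : AEStronglyMeasurable g (timeMeasure T)) :
    AEStronglyMeasurable (fun p : ℝ × ℝ => (inner ℝ (f p.1) (g p.2) : ℝ))
      ((timeMeasure T).prod (timeMeasure T)) :=
  (hf.comp_fst).inner (hg.comp_snd)

omit [InnerProductSpace ℝ H] in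
theorem integrable_norm_sq {T : ℝ} {f : ℝ → H} (hf : MemLp f 2 (timeMeasure T)) :
    Integrable (fun t => ‖f t‖ ^ 2) (timeMeasure T) :=
  hf.integrable_norm_pow (by norm_num)

/-- The bound |(x, y)| ≤ ‖x‖² + ‖y‖² separates the variables, and each term is then a convolution
integrand of two integrable functions. -/
theorem integrable_kernelForm {T : ℝ} {k : ℝ → ℝ} {f g : ℝ → H} (hk : Integrable k)
    (hf : MemLp f 2 (timeMeasure T)) (hg : MemLp g 2 (timeMeasure T)) :
    Integrable (fun p : ℝ × ℝ => k (p.2 - p.1) * inner ℝ (f p.1) (g p.2))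
      ((timeMeasure T).prod (timeMeasure T)) := by
  have h1 := integrable_kernel_mul_fst hk (integrable_norm_sq hf)
  have h2 := integrable_kernel_mul_snd hk (integrable_norm_sq hg)
  refine (h1.norm.add h2.norm).mono' ((aestronglyMeasurable_comp_sub hk.1).mul
    (aestronglyMeasurable_inner_prod hf.1 hg.1)) (Eventually.of_forall fun p => ?_)
  simp only [Pi.add_apply, norm_mul, norm_pow, norm_norm]
  have h3 := norm_inner_le_norm (𝕜 := ℝ) (f p.1) (g p.2)
  have h4 : ‖(inner ℝ (f p.1) (g p.2) : ℝ)‖ ≤ ‖f p.1‖ ^ 2 + ‖g p.2‖ ^ 2 := by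
    nlinarith [sq_nonneg (‖f p.1‖ - ‖g p.2‖), sq_nonneg (‖f p.1‖), sq_nonneg (‖g p.2‖)]
  rw [← mul_add]
  exact mul_le_mul_of_nonneg_left h4 (norm_nonneg _)

theorem kernelForm_congr {T : ℝ} {k : ℝ → ℝ} {f f' g g' : ℝ → H}
    (hf : f =ᵐ[timeMeasure T] f') (hg : g =ᵐ[timeMeasure T] g') :
    kernelForm T k f g = kernelForm T k f' g' := by
  refine integral_congr_ae ?_
  filter_upwards [Measure.quasiMeasurePreserving_fst.ae hf,
    Measure.quasiMeasurePreserving_snd.ae hg] with p h1 h2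
  rw [h1, h2]

/-- A crude Young inequality. The unit ball suffices, since homogeneity in f and g recovers the
bilinear bound in `exists_kernelOp`. -/
theorem abs_kernelForm_le {T : ℝ} {k : ℝ → ℝ} (hk : Integrable k) :
    ∃ C, 0 ≤ C ∧ ∀ f g : Lp H 2 (timeMeasure T), ‖f‖ ≤ 1 → ‖g‖ ≤ 1 →
      |kernelForm T k f g| ≤ C := by
  have norm_sq (f : Lp H 2 (timeMeasure T)) : ∫ t, ‖f t‖ ^ 2 ∂(timeMeasure T) = ‖f‖ ^ 2 := by
    rw [← real_inner_self_eq_norm_sq f, L2.inner_def]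
    simp
  have key (f : Lp H 2 (timeMeasure T)) (hf : ‖f‖ ≤ 1) (k : ℝ → ℝ) (hk : Integrable k) :
      ∫ p : ℝ × ℝ, ‖k (p.2 - p.1)‖ * ‖f p.1‖ ^ 2 ∂((timeMeasure T).prod (timeMeasure T))
        ≤ ∫ x, ‖k x‖ := by
    have hi := integrable_kernel_mul_fst hk.norm (integrable_norm_sq (Lp.memLp f))
    rw [integral_prod _ hi]
    simp only [integral_mul_const]
    calc _ ≤ ∫ s, (∫ x, ‖k x‖) * ‖f s‖ ^ 2 ∂(timeMeasure T) := by
            refine integral_mono_of_nonneg (Eventually.of_forall fun s => ?_)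
              ((integrable_norm_sq (Lp.memLp f)).const_mul _) (Eventually.of_forall fun s => ?_)
            · exact mul_nonneg (integral_nonneg fun _ => norm_nonneg _) (sq_nonneg _)
            · refine mul_le_mul_of_nonneg_right ?_ (sq_nonneg _)
              rw [← integral_sub_right_eq_self (fun x => ‖k x‖) s]
              exact integral_mono_measure (timeMeasure_le T)
                (Eventually.of_forall fun _ => norm_nonneg _) (hk.norm.comp_sub_right s)
      _ = (∫ x, ‖k x‖) * ‖f‖ ^ 2 := by rw [integral_const_mul, norm_sq]
      _ ≤ _ := by
        have : 0 ≤ ∫ x, ‖k x‖ := integral_nonneg fun _ => norm_nonneg _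
        have h1 : ‖f‖ ^ 2 ≤ 1 := pow_le_one₀ (norm_nonneg _) hf
        nlinarith
  refine ⟨(∫ x, ‖k x‖) + ∫ x, ‖k (-x)‖, add_nonneg (integral_nonneg fun _ => norm_nonneg _)
    (integral_nonneg fun _ => norm_nonneg _), fun f g hf hg => ?_⟩
  have h1 := key f hf k hk
  have h2 := key g hg _ hk.comp_neg
  rw [← integral_prod_swap] at h2
  refine (norm_integral_le_integral_norm
    fun p : ℝ × ℝ => k (p.2 - p.1) * (inner ℝ (f p.1) (g p.2) : ℝ)).trans
      (le_trans ?_ (add_le_add h1 h2))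
  have i1 := integrable_kernel_mul_fst hk.norm (integrable_norm_sq (Lp.memLp f))
  have i2 := (integrable_kernel_mul_fst hk.comp_neg.norm (integrable_norm_sq (Lp.memLp g))).swap
  have := integral_add i1 i2
  simp only [Function.comp_apply] at this
  simp only [Prod.fst_swap, Prod.snd_swap] at this ⊢
  rw [← this]
  refine integral_mono (integrable_kernelForm hk (Lp.memLp f) (Lp.memLp g)).norm (i1.add i2)
    fun p => ?_
  simp only [neg_sub, norm_mul]
  have h3 := norm_inner_le_norm (𝕜 := ℝ) (f p.1) (g p.2)
  have h4 : ‖(inner ℝ (f p.1) (g p.2) : ℝ)‖ ≤ ‖f p.1‖ ^ 2 + ‖g p.2‖ ^ 2 := by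
    nlinarith [sq_nonneg (‖f p.1‖ - ‖g p.2‖), sq_nonneg (‖f p.1‖), sq_nonneg (‖g p.2‖)]
  rw [← mul_add]
  exact mul_le_mul_of_nonneg_left h4 (norm_nonneg _)

/-- The operator comes from its bounded bilinear form by Riesz representation; the pointwise formula
is recovered later in `kernelOp_ae_eq`. -/
theorem exists_kernelOp [CompleteSpace H] (T : ℝ) {k : ℝ → ℝ} (hk : Integrable k) :
    ∃ A : Lp H 2 (timeMeasure T) →L[ℝ] Lp H 2 (timeMeasure T),
      ∀ f g, inner ℝ (A f) g = kernelForm T k f g := by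
  obtain ⟨C, hC, hb⟩ := abs_kernelForm_le (T := T) (H := H) hk
  have hi (f g : Lp H 2 (timeMeasure T)) := integrable_kernelForm hk (Lp.memLp f) (Lp.memLp g)
  let B : Lp H 2 (timeMeasure T) →ₗ[ℝ] Lp H 2 (timeMeasure T) →ₗ[ℝ] ℝ :=
    LinearMap.mk₂ ℝ (fun f g => kernelForm T k f g)
      (fun f f' g => by
        rw [kernelForm_congr (Lp.coeFn_add f f') EventuallyEq.rfl]
        simp only [kernelForm]
        rw [← integral_add (hi f g) (hi f' g)]
        simp [inner_add_left, mul_add])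
      (fun c f g => by
        rw [kernelForm_congr (Lp.coeFn_smul c f) EventuallyEq.rfl]
        simp only [kernelForm, smul_eq_mul]
        rw [← integral_const_mul]
        simp [inner_smul_left, mul_left_comm])
      (fun f g g' => by
        rw [kernelForm_congr EventuallyEq.rfl (Lp.coeFn_add g g')]
        simp only [kernelForm]
        rw [← integral_add (hi f g) (hi f g')]
        simp [inner_add_right, mul_add])
      (fun c f g => by
        rw [kernelForm_congr EventuallyEq.rfl (Lp.coeFn_smul c g)]
        simp only [kernelForm, smul_eq_mul]
        rw [← integral_const_mul]
        simp [inner_smul_right, mul_left_comm])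
  have hB (f g : Lp H 2 (timeMeasure T)) : ‖B f g‖ ≤ C * ‖f‖ * ‖g‖ := by
    rcases eq_or_ne f 0 with rfl | hf
    · simp
    rcases eq_or_ne g 0 with rfl | hg
    · simp
    have hf' : ‖f‖ ≠ 0 := norm_ne_zero_iff.mpr hf
    have hg' : ‖g‖ ≠ 0 := norm_ne_zero_iff.mpr hg
    have h1 : f = ‖f‖ • (‖f‖⁻¹ • f) := by rw [smul_smul, mul_inv_cancel₀ hf', one_smul]
    have h2 : g = ‖g‖ • (‖g‖⁻¹ • g) := by rw [smul_smul, mul_inv_cancel₀ hg', one_smul]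
    have h3 : |B (‖f‖⁻¹ • f) (‖g‖⁻¹ • g)| ≤ C := by
      refine hb _ _ ?_ ?_ <;> simp [norm_smul, hf', hg']
    have h4 : B f g = ‖f‖ * (‖g‖ * B (‖f‖⁻¹ • f) (‖g‖⁻¹ • g)) := by
      conv_lhs => rw [h1, h2]
      rw [LinearMap.map_smul₂, map_smul, smul_eq_mul, smul_eq_mul]
    rw [h4, norm_mul, norm_mul, norm_norm, norm_norm, Real.norm_eq_abs]
    calc _ ≤ ‖f‖ * (‖g‖ * C) := by gcongr
      _ = _ := by ring
  refine ⟨InnerProductSpace.continuousLinearMapOfBilin (𝕜 := ℝ) (B.mkContinuous₂ C hB), fun f g => ?_⟩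
  rw [InnerProductSpace.continuousLinearMapOfBilin_apply]
  rfl

open Classical in
/-- The convolution operator with kernel `k` on `L²(I; H)` (zero if `k` is not integrable). -/
def kernelOp [CompleteSpace H] (T : ℝ) (k : ℝ → ℝ) :
    Lp H 2 (timeMeasure T) →L[ℝ] Lp H 2 (timeMeasure T) :=
  if hk : Integrable k then (exists_kernelOp T hk).choose else 0

theorem inner_kernelOp [CompleteSpace H] {T : ℝ} {k : ℝ → ℝ} (hk : Integrable k)
    (f g : Lp H 2 (timeMeasure T)) :
    inner ℝ (kernelOp T k f) g = kernelForm T k f g := by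
  rw [kernelOp, dif_pos hk]
  exact (exists_kernelOp T hk).choose_spec f g

theorem adjoint_kernelOp [CompleteSpace H] {T : ℝ} {k : ℝ → ℝ} (hk : Integrable k) :
    ContinuousLinearMap.adjoint (kernelOp (H := H) T k) = kernelOp T fun x => k (-x) := by
  refine (ContinuousLinearMap.eq_adjoint_iff _ _).mpr (fun f g => ?_) |>.symm
  rw [inner_kernelOp hk.comp_neg, real_inner_comm, inner_kernelOp hk]
  simp only [kernelForm]
  rw [← integral_prod_swap]
  refine integral_congr_ae (Eventually.of_forall fun p => ?_)
  simp [real_inner_comm]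

omit [InnerProductSpace ℝ H] in
theorem integrable_of_memLp_two {T : ℝ} {f : ℝ → H} (hf : MemLp f 2 (timeMeasure T)) :
    Integrable f (timeMeasure T) :=
  hf.integrable (by norm_num)

theorem integrable_prod_kernel_smul {T : ℝ} {k : ℝ → ℝ} {f : ℝ → H} (hk : Integrable k)
    (hf : MemLp f 2 (timeMeasure T)) :
    Integrable (fun p : ℝ × ℝ => k (p.1 - p.2) • f p.2)
      ((timeMeasure T).prod (timeMeasure T)) := by
  have h := (integrable_kernel_mul_fst hk (integrable_of_memLp_two hf).norm).swap
  refine h.mono (((aestronglyMeasurable_comp_sub hk.1).prod_swap).smul hf.1.comp_snd)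
    (Eventually.of_forall fun p => ?_)
  simp [norm_smul]

/-- Testing the form against indicators of sets E with a constant value c identifies the integrals
of both sides over every E. -/
theorem kernelOp_ae_eq [CompleteSpace H] {T : ℝ} {k : ℝ → ℝ} (hk : Integrable k)
    (f : Lp H 2 (timeMeasure T)) :
    kernelOp T k f =ᵐ[timeMeasure T] fun t => ∫ s, k (t - s) • f s ∂(timeMeasure T) := by
  have hi := integrable_prod_kernel_smul hk (Lp.memLp f)
  refine Integrable.ae_eq_of_forall_setIntegral_eq _ _ (integrable_of_memLp_two (Lp.memLp _))
    hi.integral_prod_left fun E hE _ => ?_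
  refine ext_inner_right ℝ fun c => ?_
  have hE' : timeMeasure T E ≠ ⊤ := measure_ne_top _ _
  have hg := indicatorConstLp_coeFn (p := 2) (hs := hE) (hμs := hE') (c := c)
  have h1 := L2.inner_indicatorConstLp_eq_inner_setIntegral ℝ hE hE' c (kernelOp T k f)
  rw [real_inner_comm, ← h1, real_inner_comm, inner_kernelOp hk,
    kernelForm_congr EventuallyEq.rfl hg, kernelForm, ← integral_prod_swap, integral_prod]
  · rw [← integral_indicator hE, real_inner_comm, ← integral_inner]
    · refine integral_congr_ae ?_
      filter_upwards [hi.prod_right_ae] with t ht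
      by_cases h : t ∈ E
      · simp only [Prod.fst_swap, Prod.snd_swap, indicator_of_mem h]
        rw [← integral_inner ht]
        simp [inner_smul_right, real_inner_comm]
      · simp [h]
    · exact hi.integral_prod_left.indicator hE
  · exact (integrable_kernelForm hk (Lp.memLp f) ((memLp_congr_ae hg).mp (Lp.memLp _))).swap

end Kernel

/-! ### Composition of two nonnegative kernels -/

section Composition

variable {H : Type*} [NormedAddCommGroup H] [InnerProductSpace ℝ H] [CompleteSpace H]

/-- Fubini in three variables. As p and q are nonnegative, integrating the absolute value over r
gives |m (f, g)|, so integrability of the two-variable form is enough. With ν on I it yields the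
semigroup law; with ν on the line, the comparison of left and right integrals. -/
theorem integral_inner_kernels {T : ℝ} {ν : Measure ℝ} [SFinite ν] {p q m : ℝ → ℝ → ℝ}
    (hp : Measurable (Function.uncurry p)) (hq : Measurable (Function.uncurry q))
    (hp0 : ∀ r s, 0 ≤ p r s) (hq0 : ∀ r s, 0 ≤ q r s) {f g : ℝ → H}
    (hf : MemLp f 2 (timeMeasure T)) (hg : MemLp g 2 (timeMeasure T))
    (hpi : ∀ᵐ r ∂ν, Integrable (fun s => p r s • f s) (timeMeasure T))
    (hqi : ∀ᵐ r ∂ν, Integrable (fun t => q r t • g t) (timeMeasure T))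
    (hm : ∀ᵐ z : ℝ × ℝ ∂((timeMeasure T).prod (timeMeasure T)),
      Integrable (fun r => p r z.1 * q r z.2) ν ∧ ∫ r, p r z.1 * q r z.2 ∂ν = m z.1 z.2)
    (hmi : Integrable (fun z : ℝ × ℝ => m z.1 z.2 * inner ℝ (f z.1) (g z.2))
      ((timeMeasure T).prod (timeMeasure T))) :
    Integrable (fun r => (inner ℝ (∫ s, p r s • f s ∂(timeMeasure T))
      (∫ t, q r t • g t ∂(timeMeasure T)) : ℝ)) ν ∧
    ∫ r, inner ℝ (∫ s, p r s • f s ∂(timeMeasure T)) (∫ t, q r t • g t ∂(timeMeasure T)) ∂ν =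
      ∫ z : ℝ × ℝ, m z.1 z.2 * inner ℝ (f z.1) (g z.2)
        ∂((timeMeasure T).prod (timeMeasure T)) := by
  let G : (ℝ × ℝ) × ℝ → ℝ := fun z => p z.2 z.1.1 * q z.2 z.1.2 * inner ℝ (f z.1.1) (g z.1.2)
  have hGm : AEStronglyMeasurable G (((timeMeasure T).prod (timeMeasure T)).prod ν) := by
    refine AEStronglyMeasurable.mul ?_ ?_
    · have h1 : Measurable fun z : (ℝ × ℝ) × ℝ => p z.2 z.1.1 :=
        hp.comp (measurable_snd.prodMk (measurable_fst.comp measurable_fst))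
      have h2 : Measurable fun z : (ℝ × ℝ) × ℝ => q z.2 z.1.2 :=
        hq.comp (measurable_snd.prodMk (measurable_snd.comp measurable_fst))
      exact (h1.mul h2).aestronglyMeasurable
    · exact (aestronglyMeasurable_inner_prod hf.1 hg.1).comp_fst
  have hG : Integrable G (((timeMeasure T).prod (timeMeasure T)).prod ν) := by
    rw [integrable_prod_iff hGm]
    refine ⟨hm.mono fun z hz => hz.1.mul_const (inner ℝ (f z.1) (g z.2)), hmi.norm.congr ?_⟩
    filter_upwards [hm] with z hz
    have : ∀ r, ‖G (z, r)‖ = p r z.1 * q r z.2 * ‖(inner ℝ (f z.1) (g z.2) : ℝ)‖ := fun r => by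
      simp only [G]
      rw [norm_mul, Real.norm_of_nonneg (mul_nonneg (hp0 _ _) (hq0 _ _))]
    simp only [this, integral_mul_const, hz.2, norm_mul]
    rw [Real.norm_of_nonneg (r := m z.1 z.2)]
    rw [← hz.2]
    exact integral_nonneg fun r => mul_nonneg (hp0 _ _) (hq0 _ _)
  have key : ∀ᵐ r ∂ν, ∫ z, G (z, r) ∂((timeMeasure T).prod (timeMeasure T)) =
      inner ℝ (∫ s, p r s • f s ∂(timeMeasure T)) (∫ t, q r t • g t ∂(timeMeasure T)) := by
    filter_upwards [hpi, hqi, hG.prod_left_ae] with r h1 h2 h3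
    rw [integral_prod _ h3, real_inner_comm, ← integral_inner h1]
    refine integral_congr_ae (Eventually.of_forall fun s => ?_)
    simp only
    rw [real_inner_comm, ← integral_inner h2]
    refine integral_congr_ae (Eventually.of_forall fun t => ?_)
    simp only [G, inner_smul_left, inner_smul_right, conj_trivial]
    ring
  refine ⟨hG.integral_prod_right.congr key, ?_⟩
  rw [← integral_congr_ae key, ← integral_prod_symm _ hG, integral_prod _ hG]
  refine integral_congr_ae ?_
  filter_upwards [hm] with z hz
  simp only [G]
  rw [integral_mul_const, hz.2]

end Composition

/-! ### The truncated Riemann-Liouville kernel and the beta integral -/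

section RLKernel

/-- The kernel `x ^ (σ - 1) / Γ(σ)` on `(0, T)`. -/
def rlKernel (T σ x : ℝ) : ℝ := (Ioo 0 T).indicator (fun x => (Real.Gamma σ)⁻¹ * x ^ (σ - 1)) x

theorem rlKernel_of_mem {T σ x : ℝ} (hx : x ∈ Ioo 0 T) :
    rlKernel T σ x = (Real.Gamma σ)⁻¹ * x ^ (σ - 1) := indicator_of_mem hx _

theorem rlKernel_of_notMem {T σ x : ℝ} (hx : x ∉ Ioo 0 T) : rlKernel T σ x = 0 :=
  indicator_of_notMem hx _

theorem rlKernel_nonneg {T σ : ℝ} (hσ : 0 < σ) (x : ℝ) : 0 ≤ rlKernel T σ x :=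
  indicator_nonneg (fun _ hx => mul_nonneg (inv_nonneg.mpr (Real.Gamma_pos_of_pos hσ).le)
    (Real.rpow_nonneg hx.1.le _)) x

theorem measurable_rlKernel (T σ : ℝ) : Measurable (rlKernel T σ) :=
  ((measurable_id.pow_const _).const_mul _).indicator measurableSet_Ioo

theorem integrable_rlKernel (T : ℝ) {σ : ℝ} (hσ : 0 < σ) : Integrable (rlKernel T σ) := by
  unfold rlKernel
  rw [integrable_indicator_iff measurableSet_Ioo]
  rcases le_or_gt T 0 with hT | hT
  · simp [Ioo_eq_empty_of_le hT]
  · have := intervalIntegral.intervalIntegrable_rpow' (a := 0) (b := T) (r := σ - 1) (by linarith)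
    rw [intervalIntegrable_iff_integrableOn_Ioo_of_le hT.le] at this
    exact this.const_mul _

theorem integral_beta {a b s t : ℝ} (ha : 0 < a) (hb : 0 < b) (hst : s < t) :
    ∫ r in Ioo s t, (r - s) ^ (b - 1) * (t - r) ^ (a - 1) =
      (t - s) ^ (a + b - 1) * (Real.Gamma a * Real.Gamma b / Real.Gamma (a + b)) := by
  have h1 := Complex.betaIntegral_scaled b a (sub_pos.mpr hst)
  have h2 : ∫ r in Ioo s t, (r - s) ^ (b - 1) * (t - r) ^ (a - 1) =
      ∫ x in (0 : ℝ)..(t - s), x ^ (b - 1) * (t - s - x) ^ (a - 1) := by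
    have := intervalIntegral.integral_comp_sub_right (a := s) (b := t)
      (fun x => x ^ (b - 1) * (t - s - x) ^ (a - 1)) s
    rw [sub_self] at this
    rw [← this, intervalIntegral.integral_of_le hst.le, integral_Ioc_eq_integral_Ioo]
    refine setIntegral_congr_fun measurableSet_Ioo fun x _ => ?_
    congr 2
    ring
  rw [h2]
  have h3 : ((∫ x in (0 : ℝ)..(t - s), x ^ (b - 1) * (t - s - x) ^ (a - 1) : ℝ) : ℂ) =
      ∫ x in (0 : ℝ)..(t - s), (x : ℂ) ^ ((b : ℂ) - 1) * (((t - s : ℝ) : ℂ) - x) ^ ((a : ℂ) - 1) := by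
    rw [← intervalIntegral.integral_ofReal]
    refine intervalIntegral.integral_congr_ae (Eventually.of_forall fun x hx => ?_)
    rw [uIoc_of_le (by linarith)] at hx
    push_cast
    rw [Complex.ofReal_cpow hx.1.le, Complex.ofReal_cpow (by linarith [hx.2])]
    push_cast
    rfl
  rw [h1] at h3
  rw [Complex.betaIntegral_eq_Gamma_mul_div _ _ (by simpa) (by simpa)] at h3
  have h4 := Complex.ofReal_cpow (sub_pos.mpr hst).le (b + a - 1)
  apply Complex.ofReal_injective
  rw [h3, ← Complex.ofReal_add, Complex.Gamma_ofReal, Complex.Gamma_ofReal, Complex.Gamma_ofReal]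
  push_cast at h4 ⊢
  rw [← h4, add_comm b a]
  ring

theorem integrableOn_beta {a b s t : ℝ} (ha : 0 < a) (hb : 0 < b) (hst : s < t) :
    IntegrableOn (fun r => (r - s) ^ (b - 1) * (t - r) ^ (a - 1)) (Ioo s t) := by
  -- A non-integrable function has Bochner integral 0, so a positive value proves integrability. The
  -- same device recurs below.
  refine not_imp_comm.1 integral_undef ?_
  rw [integral_beta ha hb hst]
  have h1 := Real.Gamma_pos_of_pos ha
  have h2 := Real.Gamma_pos_of_pos hb
  have h3 := Real.Gamma_pos_of_pos (add_pos ha hb)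
  have h4 := Real.rpow_pos_of_pos (sub_pos.mpr hst) (a + b - 1)
  positivity

/-- The product lives on s < r < t, where the truncation at T is invisible because all differences
stay below T. -/
theorem rlKernel_comp {T a b s t : ℝ} (ha : 0 < a) (hb : 0 < b) (hs : s ∈ Ioo 0 T)
    (ht : t ∈ Ioo 0 T) :
    Integrable (fun r => rlKernel T b (r - s) * rlKernel T a (t - r)) (timeMeasure T) ∧
    ∫ r, rlKernel T b (r - s) * rlKernel T a (t - r) ∂(timeMeasure T) =
      rlKernel T (a + b) (t - s) := by
  have h : (fun r => rlKernel T b (r - s) * rlKernel T a (t - r)) =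
      (Ioo s t).indicator (fun r => ((Real.Gamma b)⁻¹ * (Real.Gamma a)⁻¹) *
        ((r - s) ^ (b - 1) * (t - r) ^ (a - 1))) := by
    ext r
    by_cases hr : r ∈ Ioo s t
    · rw [indicator_of_mem hr, rlKernel_of_mem, rlKernel_of_mem]
      · ring
      · exact ⟨by linarith [hr.2], by linarith [hr.1, hs.1, ht.2]⟩
      · exact ⟨by linarith [hr.1], by linarith [hr.2, hs.1, ht.2]⟩
    · rw [indicator_of_notMem hr]
      rw [mem_Ioo, not_and_or] at hr
      rcases hr with hr | hr
      · rw [rlKernel_of_notMem, zero_mul]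
        exact fun h => hr (by linarith [h.1])
      · rw [mul_comm, rlKernel_of_notMem, zero_mul]
        exact fun h => hr (by linarith [h.1])
  have hsub : Ioo s t ⊆ Ioo 0 T := Ioo_subset_Ioo hs.1.le ht.2.le
  rw [h, timeMeasure]
  rcases le_or_gt t s with hst | hst
  · rw [Ioo_eq_empty_of_le hst, rlKernel_of_notMem fun h => by linarith [h.1]]
    simp
  · constructor
    · exact (((integrable_indicator_iff measurableSet_Ioo).mpr
        (Integrable.const_mul (integrableOn_beta ha hb hst) _))).restrict
    · rw [setIntegral_indicator measurableSet_Ioo, inter_eq_right.mpr hsub, integral_const_mul,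
        integral_beta ha hb hst, rlKernel_of_mem ⟨by linarith, by linarith [hs.1, ht.2]⟩]
      have h1 := (Real.Gamma_pos_of_pos ha).ne'
      have h2 := (Real.Gamma_pos_of_pos hb).ne'
      field_simp

end RLKernel

/-! ### Fractional integrals as operators, and their semigroup law -/

section FracInt

variable {H : Type*} [NormedAddCommGroup H] [InnerProductSpace ℝ H] [CompleteSpace H]

/-- The left Riemann-Liouville integral of order `σ` as an operator on `L²(I; H)`. Its adjoint is
the right Riemann-Liouville integral. -/
def fracInt (T σ : ℝ) : Lp H 2 (timeMeasure T) →L[ℝ] Lp H 2 (timeMeasure T) :=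
  kernelOp T (rlKernel T σ)

theorem inner_fracInt {T σ : ℝ} (hσ : 0 < σ) (f g : Lp H 2 (timeMeasure T)) :
    inner ℝ (fracInt T σ f) g = kernelForm T (rlKernel T σ) f g :=
  inner_kernelOp (integrable_rlKernel T hσ) f g

/-- The right Riemann-Liouville integral of order `σ` as an operator on `L²(I; H)`. -/
def fracIntRight (T σ : ℝ) : Lp H 2 (timeMeasure T) →L[ℝ] Lp H 2 (timeMeasure T) :=
  ContinuousLinearMap.adjoint (fracInt T σ)

theorem inner_fracInt_left (T σ : ℝ) (f g : Lp H 2 (timeMeasure T)) :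
    inner ℝ (fracInt T σ f) g = inner ℝ f (fracIntRight T σ g) :=
  (ContinuousLinearMap.adjoint_inner_right _ _ _).symm

theorem inner_fracInt_right (T σ : ℝ) (f g : Lp H 2 (timeMeasure T)) :
    inner ℝ f (fracInt T σ g) = inner ℝ (fracIntRight T σ f) g :=
  (ContinuousLinearMap.adjoint_inner_left _ _ _).symm

theorem fracInt_ae_eq_kernel {T σ : ℝ} (hσ : 0 < σ) (f : Lp H 2 (timeMeasure T)) :
    fracInt T σ f =ᵐ[timeMeasure T] fun t => ∫ s, rlKernel T σ (t - s) • f s ∂(timeMeasure T) :=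
  kernelOp_ae_eq (integrable_rlKernel T hσ) f

theorem fracIntRight_ae_eq_kernel {T σ : ℝ} (hσ : 0 < σ) (f : Lp H 2 (timeMeasure T)) :
    fracIntRight T σ f =ᵐ[timeMeasure T]
      fun t => ∫ s, rlKernel T σ (s - t) • f s ∂(timeMeasure T) := by
  rw [fracIntRight, fracInt, adjoint_kernelOp (integrable_rlKernel T hσ)]
  simpa using kernelOp_ae_eq (integrable_rlKernel T hσ).comp_neg f

omit [CompleteSpace H] in
theorem rlIntLeft_eq_kernel {T σ t : ℝ} (ht : t ∈ Ioo 0 T) (f : ℝ → H) :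
    rlIntLeft σ f t = ∫ s, rlKernel T σ (t - s) • f s ∂(timeMeasure T) := by
  have h : ∀ s ∈ Ioo 0 T, rlKernel T σ (t - s) • f s =
      (Ioo 0 t).indicator (fun s => (Real.Gamma σ)⁻¹ • (t - s) ^ (σ - 1) • f s) s := by
    intro s hs
    by_cases h : s < t
    · rw [indicator_of_mem (show s ∈ Ioo 0 t from ⟨hs.1, h⟩),
        rlKernel_of_mem ⟨by linarith, by linarith [ht.2, hs.1]⟩, mul_smul]
    · rw [indicator_of_notMem (fun h' => h h'.2), rlKernel_of_notMem fun h' => h (by linarith [h'.1]),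
        zero_smul]
  rw [timeMeasure, setIntegral_congr_fun measurableSet_Ioo h, setIntegral_indicator measurableSet_Ioo,
    inter_eq_right.mpr (Ioo_subset_Ioo le_rfl ht.2.le), integral_smul, rlIntLeft,
    intervalIntegral.integral_of_le ht.1.le, integral_Ioc_eq_integral_Ioo]

omit [CompleteSpace H] in
theorem rlIntRight_eq_kernel {T σ t : ℝ} (ht : t ∈ Ioo 0 T) (f : ℝ → H) :
    rlIntRight T σ f t = ∫ s, rlKernel T σ (s - t) • f s ∂(timeMeasure T) := by
  have h : ∀ s ∈ Ioo 0 T, rlKernel T σ (s - t) • f s =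
      (Ioo t T).indicator (fun s => (Real.Gamma σ)⁻¹ • (s - t) ^ (σ - 1) • f s) s := by
    intro s hs
    by_cases h : t < s
    · rw [indicator_of_mem (show s ∈ Ioo t T from ⟨h, hs.2⟩),
        rlKernel_of_mem ⟨by linarith, by linarith [ht.1, hs.2]⟩, mul_smul]
    · rw [indicator_of_notMem (fun h' => h h'.1), rlKernel_of_notMem fun h' => h (by linarith [h'.1]),
        zero_smul]
  rw [timeMeasure, setIntegral_congr_fun measurableSet_Ioo h, setIntegral_indicator measurableSet_Ioo,
    inter_eq_right.mpr (Ioo_subset_Ioo ht.1.le le_rfl), integral_smul, rlIntRight,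
    intervalIntegral.integral_of_le ht.2.le, integral_Ioc_eq_integral_Ioo]

theorem ae_mem_timeMeasure (T : ℝ) : ∀ᵐ t ∂(timeMeasure T), t ∈ Ioo 0 T :=
  ae_restrict_mem measurableSet_Ioo

theorem ae_prod_mem_timeMeasure (T : ℝ) : ∀ᵐ z : ℝ × ℝ ∂((timeMeasure T).prod (timeMeasure T)),
    z.1 ∈ Ioo 0 T ∧ z.2 ∈ Ioo 0 T :=
  (Measure.quasiMeasurePreserving_fst.ae (ae_mem_timeMeasure T)).and
    (Measure.quasiMeasurePreserving_snd.ae (ae_mem_timeMeasure T))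

/-- The left Riemann-Liouville integral of `u ∈ L²` represents `fracInt`. -/
theorem fracInt_ae_eq {T σ : ℝ} (hσ : 0 < σ) {u : ℝ → H} {f : Lp H 2 (timeMeasure T)}
    (hf : f =ᵐ[timeMeasure T] u) : fracInt T σ f =ᵐ[timeMeasure T] rlIntLeft σ u := by
  filter_upwards [fracInt_ae_eq_kernel hσ f, ae_mem_timeMeasure T] with t h1 h2
  rw [h1, rlIntLeft_eq_kernel h2]
  refine integral_congr_ae ?_
  filter_upwards [hf] with s hs
  rw [hs]

theorem fracIntRight_ae_eq {T σ : ℝ} (hσ : 0 < σ) {u : ℝ → H} {f : Lp H 2 (timeMeasure T)}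
    (hf : f =ᵐ[timeMeasure T] u) :
    fracIntRight T σ f =ᵐ[timeMeasure T] rlIntRight T σ u := by
  filter_upwards [fracIntRight_ae_eq_kernel hσ f, ae_mem_timeMeasure T] with t h1 h2
  rw [h1, rlIntRight_eq_kernel h2]
  refine integral_congr_ae ?_
  filter_upwards [hf] with s hs
  rw [hs]

/-- Moving J^a to the other side turns the composition into (J^b f, J*^a g), an integral over the
intermediate time r, to which the beta integral applies. -/
theorem fracInt_add {T a b : ℝ} (ha : 0 < a) (hb : 0 < b) (f : Lp H 2 (timeMeasure T)) :
    fracInt T (a + b) f = fracInt T a (fracInt T b f) := by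
  refine ext_inner_right ℝ fun g => ?_
  rw [inner_fracInt (add_pos ha hb), inner_fracInt_left, L2.inner_def,
    kernelForm]
  have hka := integrable_rlKernel T ha
  have hkb := integrable_rlKernel T hb
  have := (integral_inner_kernels (T := T) (ν := timeMeasure T)
    (p := fun r s => rlKernel T b (r - s)) (q := fun r t => rlKernel T a (t - r))
    (m := fun s t => rlKernel T (a + b) (t - s))
    ((measurable_rlKernel T b).comp (measurable_fst.sub measurable_snd))
    ((measurable_rlKernel T a).comp (measurable_snd.sub measurable_fst))
    (fun _ _ => rlKernel_nonneg hb _) (fun _ _ => rlKernel_nonneg ha _) (Lp.memLp f) (Lp.memLp g)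
    (integrable_prod_kernel_smul hkb (Lp.memLp f)).prod_right_ae
    (by simpa using (integrable_prod_kernel_smul hka.comp_neg (Lp.memLp g)).prod_right_ae)
    ((ae_prod_mem_timeMeasure T).mono fun z hz => rlKernel_comp ha hb hz.1 hz.2)
    (integrable_kernelForm (integrable_rlKernel T (add_pos ha hb)) (Lp.memLp f) (Lp.memLp g))).2
  rw [← this]
  refine integral_congr_ae ?_
  filter_upwards [fracInt_ae_eq_kernel hb f, fracIntRight_ae_eq_kernel ha g] with t h1 h2
  rw [h1, h2]

theorem fracIntRight_add {T a b : ℝ} (ha : 0 < a) (hb : 0 < b) (f : Lp H 2 (timeMeasure T)) :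
    fracIntRight T (a + b) f = fracIntRight T a (fracIntRight T b f) := by
  refine ext_inner_right ℝ fun g => ?_
  rw [← inner_fracInt_right, ← inner_fracInt_right, ← inner_fracInt_right, add_comm,
    fracInt_add hb ha]

end FracInt

/-! ### Autocorrelation of the half-line kernel -/

section HalfLine

/-- Γ(1-a) (x+d)^{a-1} is the Laplace transform of y^{-a} at x + d. After exchanging the integrals,
both are gamma integrals; the one in y converges at 0 exactly when a < 1/2. -/
theorem integral_rpow_mul_add_rpow {a d : ℝ} (ha : 0 < a) (ha' : a < 1 / 2) (hd : 0 < d) :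
    ∫ x in Ioi (0 : ℝ), x ^ (a - 1) * (x + d) ^ (a - 1) =
      Real.Gamma a * Real.Gamma (1 - 2 * a) / Real.Gamma (1 - a) * d ^ (2 * a - 1) := by
  let G : ℝ × ℝ → ℝ := fun p =>
    p.1 ^ (a - 1) * Real.exp (-(p.2 * p.1)) * (p.2 ^ (-a) * Real.exp (-(d * p.2)))
  have hΓ := Real.Gamma_pos_of_pos ha
  have hx (y : ℝ) (hy : 0 < y) : ∫ x in Ioi (0 : ℝ), G (x, y) =
      Real.Gamma a * (y ^ (1 - 2 * a - 1) * Real.exp (-(d * y))) := by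
    simp only [G]
    rw [integral_mul_const, Real.integral_rpow_mul_exp_neg_mul_Ioi ha hy, one_div,
      Real.inv_rpow hy.le, ← Real.rpow_neg hy.le]
    rw [show 1 - 2 * a - 1 = -a + -a by ring, Real.rpow_add hy]
    ring
  have hy (x : ℝ) (hx : 0 < x) : ∫ y in Ioi (0 : ℝ), G (x, y) =
      Real.Gamma (1 - a) * (x ^ (a - 1) * (x + d) ^ (a - 1)) := by
    have h (y : ℝ) : G (x, y) = x ^ (a - 1) *
        (y ^ (1 - a - 1) * Real.exp (-((x + d) * y))) := by
      simp only [G]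
      rw [show -((x + d) * y) = -(y * x) + -(d * y) by ring, Real.exp_add,
        show 1 - a - 1 = -a by ring]
      ring
    simp only [h]
    rw [integral_const_mul, Real.integral_rpow_mul_exp_neg_mul_Ioi (by linarith) (by linarith),
      one_div, Real.inv_rpow (by linarith), ← Real.rpow_neg (by linarith), neg_sub]
    ring
  have hgi := Real.integral_rpow_mul_exp_neg_mul_Ioi (a := 1 - 2 * a) (by linarith) hd
  have hgpos := Real.Gamma_pos_of_pos (s := 1 - 2 * a) (by linarith)
  have hgp : (0 : ℝ) < (1 / d) ^ (1 - 2 * a) := by positivity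
  have hgi' : IntegrableOn (fun y => y ^ (1 - 2 * a - 1) * Real.exp (-(d * y))) (Ioi 0) := by
    refine not_imp_comm.1 integral_undef ?_
    rw [hgi]
    positivity
  have hG : Integrable G ((volume.restrict (Ioi 0)).prod (volume.restrict (Ioi 0))) := by
    have hm : AEStronglyMeasurable G ((volume.restrict (Ioi 0)).prod (volume.restrict (Ioi 0))) := by
      refine Measurable.aestronglyMeasurable ?_
      simp only [G]
      fun_prop
    rw [integrable_prod_iff' hm]
    constructor
    · filter_upwards [ae_restrict_mem measurableSet_Ioi] with y hy
      refine not_imp_comm.1 integral_undef ?_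
      rw [hx y hy]
      have : (0 : ℝ) < y ^ (1 - 2 * a - 1) := Real.rpow_pos_of_pos hy _
      positivity
    · refine (hgi'.const_mul (Real.Gamma a)).congr ?_
      filter_upwards [ae_restrict_mem measurableSet_Ioi] with y hy
      rw [← hx y hy]
      refine setIntegral_congr_fun measurableSet_Ioi fun x hx => ?_
      have h1 : (0 : ℝ) < x ^ (a - 1) := Real.rpow_pos_of_pos hx _
      have h2 : (0 : ℝ) < y ^ (-a) := Real.rpow_pos_of_pos hy _
      exact (Real.norm_of_nonneg (by positivity)).symm
  have h1 : ∫ z, G z ∂((volume.restrict (Ioi 0)).prod (volume.restrict (Ioi 0))) =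
      Real.Gamma (1 - a) * ∫ x in Ioi (0 : ℝ), x ^ (a - 1) * (x + d) ^ (a - 1) := by
    rw [integral_prod _ hG, ← integral_const_mul]
    exact setIntegral_congr_fun measurableSet_Ioi fun x hx => hy x hx
  have h2 : ∫ z, G z ∂((volume.restrict (Ioi 0)).prod (volume.restrict (Ioi 0))) =
      Real.Gamma a * (Real.Gamma (1 - 2 * a) * d ^ (2 * a - 1)) := by
    rw [integral_prod_symm _ hG]
    rw [setIntegral_congr_fun measurableSet_Ioi fun y hy => hx y hy, integral_const_mul, hgi,
      one_div, Real.inv_rpow hd.le, ← Real.rpow_neg hd.le, neg_sub]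
    ring
  have h3 := Real.Gamma_pos_of_pos (s := 1 - a) (by linarith)
  rw [h1] at h2
  rw [div_mul_eq_mul_div, eq_div_iff h3.ne']
  linear_combination h2

/-- The kernel `x ^ (a - 1) / Γ(a)` on the half-line. -/
def halfKernel (a x : ℝ) : ℝ := (Ioi 0).indicator (fun x => (Real.Gamma a)⁻¹ * x ^ (a - 1)) x

theorem halfKernel_nonneg {a : ℝ} (ha : 0 < a) (x : ℝ) : 0 ≤ halfKernel a x :=
  indicator_nonneg (fun _ hx => mul_nonneg (inv_nonneg.mpr (Real.Gamma_pos_of_pos ha).le)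
    (Real.rpow_nonneg (le_of_lt hx) _)) x

theorem measurable_halfKernel (a : ℝ) : Measurable (halfKernel a) :=
  ((measurable_id.pow_const _).const_mul _).indicator measurableSet_Ioi

theorem halfKernel_eq_rlKernel {R a x : ℝ} (hx : x < R) : halfKernel a x = rlKernel R a x := by
  by_cases h : 0 < x
  · rw [rlKernel_of_mem ⟨h, hx⟩, halfKernel, indicator_of_mem (mem_Ioi.mpr h)]
  · rw [rlKernel_of_notMem fun h' => h h'.1, halfKernel, indicator_of_notMem (mt mem_Ioi.mp h)]

/-- The constant in `integral_halfKernel`. -/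
def halfConst (a : ℝ) : ℝ := Real.Gamma (1 - 2 * a) / (Real.Gamma a * Real.Gamma (1 - a))

theorem halfConst_pos {a : ℝ} (ha : 0 < a) (ha' : a < 1 / 2) : 0 < halfConst a :=
  div_pos (Real.Gamma_pos_of_pos (by linarith))
    (mul_pos (Real.Gamma_pos_of_pos ha) (Real.Gamma_pos_of_pos (by linarith)))

/-- Euler's reflection formula at a and at 2a, combined with sin 2πa = 2 sin πa cos πa. -/
theorem cos_mul_halfConst {a : ℝ} (ha : 0 < a) (ha' : a < 1 / 2) :
    Real.cos (Real.pi * a) * (2 * (halfConst a * Real.Gamma (2 * a))) = 1 := by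
  have h1 := Real.Gamma_mul_Gamma_one_sub a
  have h2 := Real.Gamma_mul_Gamma_one_sub (2 * a)
  have hs : 0 < Real.sin (Real.pi * a) :=
    Real.sin_pos_of_pos_of_lt_pi (by positivity) (by nlinarith [Real.pi_pos])
  have hs2 : 0 < Real.sin (Real.pi * (2 * a)) :=
    Real.sin_pos_of_pos_of_lt_pi (by positivity) (by nlinarith [Real.pi_pos])
  have h3 : Real.sin (Real.pi * (2 * a)) =
      2 * Real.sin (Real.pi * a) * Real.cos (Real.pi * a) := by
    rw [← Real.sin_two_mul]; ring_nf
  have hc : Real.cos (Real.pi * a) ≠ 0 := by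
    intro h
    rw [h, mul_zero] at h3
    exact hs2.ne' h3
  have h4 : halfConst a * Real.Gamma (2 * a) =
      (Real.Gamma (2 * a) * Real.Gamma (1 - 2 * a)) / (Real.Gamma a * Real.Gamma (1 - a)) := by
    rw [halfConst]; ring
  rw [h4, h1, h2, h3]
  have := Real.pi_pos
  field_simp

theorem integral_halfKernel_of_lt {a s t : ℝ} (ha : 0 < a) (ha' : a < 1 / 2) (hst : s < t) :
    ∫ r, halfKernel a (r - s) * halfKernel a (r - t) = halfConst a * (t - s) ^ (2 * a - 1) := by
  rw [← integral_add_right_eq_self (fun r => halfKernel a (r - s) * halfKernel a (r - t)) t]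
  have h : (fun x => halfKernel a (x + t - s) * halfKernel a (x + t - t)) =
      (Ioi 0).indicator (fun x => ((Real.Gamma a)⁻¹ * (Real.Gamma a)⁻¹) *
        (x ^ (a - 1) * (x + (t - s)) ^ (a - 1))) := by
    ext x
    rw [add_sub_cancel_right, add_sub_assoc]
    by_cases hx : 0 < x
    · rw [indicator_of_mem (show x ∈ Ioi 0 from hx), halfKernel, halfKernel,
        indicator_of_mem (show x ∈ Ioi 0 from hx),
        indicator_of_mem (show x + (t - s) ∈ Ioi 0 from by simp only [mem_Ioi]; linarith)]
      ring
    · rw [indicator_of_notMem (show x ∉ Ioi 0 from hx), halfKernel, halfKernel,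
        indicator_of_notMem (show x ∉ Ioi 0 from hx), mul_zero]
  rw [h, integral_indicator measurableSet_Ioi, integral_const_mul,
    integral_rpow_mul_add_rpow ha ha' (by linarith), halfConst]
  have h1 := (Real.Gamma_pos_of_pos ha).ne'
  field_simp

theorem integral_halfKernel {a s t : ℝ} (ha : 0 < a) (ha' : a < 1 / 2) (hst : s ≠ t) :
    ∫ r, halfKernel a (r - s) * halfKernel a (r - t) = halfConst a * |t - s| ^ (2 * a - 1) := by
  rcases lt_or_gt_of_ne hst with h | h
  · rw [integral_halfKernel_of_lt ha ha' h, abs_of_pos (sub_pos.mpr h)]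
  · simp only [mul_comm (halfKernel a (_ - s))]
    rw [integral_halfKernel_of_lt ha ha' h, abs_of_neg (sub_neg.mpr h), neg_sub]

theorem integrable_halfKernel_mul {a s t : ℝ} (ha : 0 < a) (ha' : a < 1 / 2) (hst : s ≠ t) :
    Integrable fun r => halfKernel a (r - s) * halfKernel a (r - t) := by
  refine not_imp_comm.1 integral_undef ?_
  rw [integral_halfKernel ha ha' hst]
  have h1 := halfConst_pos ha ha'
  have h2 : 0 < |t - s| ^ (2 * a - 1) :=
    Real.rpow_pos_of_pos (abs_pos.mpr (sub_ne_zero.mpr hst.symm)) _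
  positivity

theorem abs_rpow_eq_rlKernel {T σ s t : ℝ} (hσ : 0 < σ) (hst : s ≠ t) (hs : s ∈ Ioo 0 T)
    (ht : t ∈ Ioo 0 T) :
    |t - s| ^ (σ - 1) = Real.Gamma σ * (rlKernel T σ (t - s) + rlKernel T σ (s - t)) := by
  have h1 := (Real.Gamma_pos_of_pos hσ).ne'
  rcases lt_or_gt_of_ne hst with h | h
  · rw [rlKernel_of_mem ⟨by linarith, by linarith [hs.1, ht.2]⟩,
      rlKernel_of_notMem fun h' => by linarith [h'.1], abs_of_pos (sub_pos.mpr h)]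
    field_simp
    ring
  · rw [rlKernel_of_mem (x := s - t) ⟨by linarith, by linarith [ht.1, hs.2]⟩,
      rlKernel_of_notMem fun h' => by linarith [h'.1], abs_of_neg (sub_neg.mpr h), neg_sub]
    field_simp
    ring

end HalfLine

/-! ### The right integral is controlled by the left one -/

section Comparison

variable {H : Type*} [NormedAddCommGroup H] [InnerProductSpace ℝ H] [CompleteSpace H]

theorem ae_prod_ne (T : ℝ) :
    ∀ᵐ z : ℝ × ℝ ∂((timeMeasure T).prod (timeMeasure T)), z.1 ≠ z.2 := by
  have hm : MeasurableSet {z : ℝ × ℝ | z.1 ≠ z.2} :=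
    (measurableSet_eq_fun measurable_fst measurable_snd).compl
  rw [Measure.ae_prod_iff_ae_ae hm]
  refine Eventually.of_forall fun x => ?_
  unfold timeMeasure
  filter_upwards [ae_restrict_of_ae (Measure.ae_ne volume x)] with y hy
  exact hy.symm

theorem kernelForm_rlKernel_neg {T σ : ℝ} (hσ : 0 < σ) (f : Lp H 2 (timeMeasure T)) :
    kernelForm T (fun x => rlKernel T σ (-x)) f f = inner ℝ (fracInt T σ f) f := by
  rw [← inner_kernelOp (integrable_rlKernel T hσ).comp_neg,
    ← adjoint_kernelOp (integrable_rlKernel T hσ), ContinuousLinearMap.adjoint_inner_left,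
    real_inner_comm, fracInt]

/-- The norm of a convolution `g = κ * f` on `I`, bounded by the norm on the whole line, which is
the quadratic form with kernel `halfConst a * |t - s| ^ (2 * a - 1)`. -/
theorem cos_mul_norm_sq_le {T a : ℝ} (ha : 0 < a) (ha' : a < 1 / 2) {κ κT : ℝ → ℝ}
    (hκm : Measurable κ) (hκ0 : ∀ x, 0 ≤ κ x)
    (hκi : ∀ R, ∃ k, Integrable k ∧ ∀ x, |x| < R → k x = κ x)
    (hκT : ∀ x, |x| < T → κT x = κ x)
    (hκ : ∀ s t, s ≠ t → Integrable (fun r => κ (r - s) * κ (r - t)) ∧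
      ∫ r, κ (r - s) * κ (r - t) = halfConst a * |t - s| ^ (2 * a - 1))
    (f g : Lp H 2 (timeMeasure T))
    (hg : g =ᵐ[timeMeasure T] fun t => ∫ s, κT (t - s) • f s ∂(timeMeasure T)) :
    Real.cos (Real.pi * a) * ‖g‖ ^ 2 ≤ inner ℝ (fracInt T (2 * a) f) f := by
  have h2a : 0 < 2 * a := by linarith
  have hk := integrable_rlKernel T h2a
  have hf := Lp.memLp f
  have hi1 := integrable_kernelForm hk hf hf
  have hi2 := integrable_kernelForm hk.comp_neg hf hf
  let c := halfConst a * Real.Gamma (2 * a)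
  let m : ℝ → ℝ → ℝ := fun s t => c * (rlKernel T (2 * a) (t - s) + rlKernel T (2 * a) (-(t - s)))
  have hmeq : (fun z : ℝ × ℝ => m z.1 z.2 * (inner ℝ (f z.1) (f z.2) : ℝ)) = fun z =>
      c * (rlKernel T (2 * a) (z.2 - z.1) * inner ℝ (f z.1) (f z.2) +
        rlKernel T (2 * a) (-(z.2 - z.1)) * inner ℝ (f z.1) (f z.2)) := by
    ext z; simp only [m]; ring
  have hpi : ∀ᵐ r, Integrable (fun s => κ (r - s) • f s) (timeMeasure T) := by
    -- The kernel κ need not be integrable on the line. For |r| < N only its values on |x| < N + T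
    -- enter, so it is replaced there by an integrable kernel.
    have : ∀ N : ℕ, ∀ᵐ r, r ∈ Ioo (-(N : ℝ)) N →
        Integrable (fun s => κ (r - s) • f s) (timeMeasure T) := by
      intro N
      obtain ⟨k, hk, hkκ⟩ := hκi (N + T)
      have h := ((integrable_of_memLp_two hf).convolution_integrand
        (ContinuousLinearMap.lsmul ℝ ℝ).flip hk).prod_right_ae
      filter_upwards [h] with r hr hrN
      refine hr.congr ?_
      filter_upwards [ae_mem_timeMeasure T] with s hs
      simp only [ContinuousLinearMap.flip_apply, ContinuousLinearMap.lsmul_apply]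
      rw [hkκ]
      rw [abs_lt]
      constructor <;> linarith [hrN.1, hrN.2, hs.1, hs.2]
    filter_upwards [ae_all_iff.mpr this] with r hr
    obtain ⟨N, hN⟩ := exists_nat_gt |r|
    exact hr N (abs_lt.mp hN)
  have hmain := integral_inner_kernels (T := T) (ν := volume) (f := f) (g := f)
    (p := fun r s => κ (r - s)) (q := fun r t => κ (r - t)) (m := m)
    (hκm.comp (measurable_fst.sub measurable_snd)) (hκm.comp (measurable_fst.sub measurable_snd))
    (fun _ _ => hκ0 _) (fun _ _ => hκ0 _) hf hf hpi hpi
    (by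
      filter_upwards [ae_prod_mem_timeMeasure T, ae_prod_ne T] with z hz hne
      refine ⟨(hκ _ _ hne).1, ?_⟩
      rw [(hκ _ _ hne).2, abs_rpow_eq_rlKernel h2a hne hz.1 hz.2]
      simp only [m, c, neg_sub]
      ring)
    (by rw [hmeq]; exact (hi1.add hi2).const_mul c)
  have h1 : ‖g‖ ^ 2 ≤ 2 * c * inner ℝ (fracInt T (2 * a) f) f := by
    calc ‖g‖ ^ 2 = ∫ r in Ioo 0 T, inner ℝ (∫ s, κ (r - s) • f s ∂(timeMeasure T))
          (∫ t, κ (r - t) • f t ∂(timeMeasure T)) := by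
          rw [← real_inner_self_eq_norm_sq, L2.inner_def]
          refine integral_congr_ae ?_
          filter_upwards [hg, ae_mem_timeMeasure T] with r h1 h2
          have : ∫ s, κT (r - s) • f s ∂(timeMeasure T) =
              ∫ s, κ (r - s) • f s ∂(timeMeasure T) := by
            refine integral_congr_ae ?_
            filter_upwards [ae_mem_timeMeasure T] with s hs
            rw [hκT]
            rw [abs_lt]
            constructor <;> linarith [hs.1, hs.2, h2.1, h2.2]
          rw [h1, this]
      _ ≤ ∫ r, inner ℝ (∫ s, κ (r - s) • f s ∂(timeMeasure T))
          (∫ t, κ (r - t) • f t ∂(timeMeasure T)) :=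
          setIntegral_le_integral hmain.1 (Eventually.of_forall fun r => real_inner_self_nonneg)
      _ = c * (kernelForm T (rlKernel T (2 * a)) f f +
          kernelForm T (fun x => rlKernel T (2 * a) (-x)) f f) := by
          rw [hmain.2, hmeq, integral_const_mul, integral_add hi1 hi2]
          rfl
      _ = _ := by
          rw [kernelForm_rlKernel_neg h2a, ← inner_fracInt h2a]
          ring
  have hcos : 0 ≤ Real.cos (Real.pi * a) := Real.cos_nonneg_of_mem_Icc
    ⟨by nlinarith [Real.pi_pos], by nlinarith [Real.pi_pos]⟩
  calc _ ≤ Real.cos (Real.pi * a) * (2 * c * inner ℝ (fracInt T (2 * a) f) f) :=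
        mul_le_mul_of_nonneg_left h1 hcos
    _ = (Real.cos (Real.pi * a) * (2 * c)) * inner ℝ (fracInt T (2 * a) f) f := by ring
    _ = _ := by rw [cos_mul_halfConst ha ha', one_mul]

theorem cos_mul_norm_fracIntRight_sq_le {T a : ℝ} (ha : 0 < a) (ha' : a < 1 / 2)
    (f : Lp H 2 (timeMeasure T)) :
    Real.cos (Real.pi * a) * ‖fracIntRight T a f‖ ^ 2 ≤ inner ℝ (fracInt T (2 * a) f) f := by
  refine cos_mul_norm_sq_le ha ha' (κ := fun x => halfKernel a (-x))
    (κT := fun x => rlKernel T a (-x)) ((measurable_halfKernel a).comp measurable_neg)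
    (fun _ => halfKernel_nonneg ha _)
    (fun R => ⟨fun x => rlKernel R a (-x), (integrable_rlKernel R ha).comp_neg, fun _ hx =>
      (halfKernel_eq_rlKernel (by linarith [(abs_lt.mp hx).1])).symm⟩)
    (fun _ hx => (halfKernel_eq_rlKernel (by linarith [(abs_lt.mp hx).1])).symm)
    (fun s t hst => ?_) f _ (by simpa using fracIntRight_ae_eq_kernel ha f)
  -- The reflection r ↦ s + t - r reduces the autocorrelation of the reversed kernel to that of
  -- `halfKernel`.
  have h : (fun r => halfKernel a (-(r - s)) * halfKernel a (-(r - t))) = fun r =>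
      (fun r => halfKernel a (r - s) * halfKernel a (r - t)) (s + t - r) := by
    ext r
    rw [mul_comm]
    congr 2 <;> ring
  rw [h]
  exact ⟨(integrable_halfKernel_mul ha ha' hst).comp_sub_left (s + t), by
    rw [integral_sub_left_eq_self (fun r => halfKernel a (r - s) * halfKernel a (r - t)),
      integral_halfKernel ha ha' hst]⟩

/-- By Cauchy-Schwarz this turns the quadratic bound into a linear comparison of norms. -/
theorem inner_fracInt_two_mul {T a : ℝ} (ha : 0 < a) (f : Lp H 2 (timeMeasure T)) :
    inner ℝ (fracInt T (2 * a) f) f = inner ℝ (fracInt T a f) (fracIntRight T a f) := by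
  rw [two_mul, fracInt_add ha ha, inner_fracInt_left]

/-- The right Riemann-Liouville integral of order `a < 1 / 2` is bounded by the left one. -/
theorem cos_mul_norm_fracIntRight_le {T a : ℝ} (ha : 0 < a) (ha' : a < 1 / 2)
    (f : Lp H 2 (timeMeasure T)) :
    Real.cos (Real.pi * a) * ‖fracIntRight T a f‖ ≤ ‖fracInt T a f‖ := by
  have h1 := cos_mul_norm_fracIntRight_sq_le ha ha' f
  rw [inner_fracInt_two_mul ha] at h1
  have h2 := h1.trans (real_inner_le_norm _ _)
  rcases (norm_nonneg (fracIntRight T a f)).eq_or_lt with h | h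
  · rw [← h, mul_zero]; exact norm_nonneg _
  · nlinarith

end Comparison

/-! ### Test functions, du Bois-Reymond's lemma, injectivity of J^1 and J*^1 -/

section Test

variable {H : Type*} [NormedAddCommGroup H] [InnerProductSpace ℝ H]

theorem ip_eq_inner {T : ℝ} {f g : ℝ → H} {F G : Lp H 2 (timeMeasure T)}
    (hF : F =ᵐ[timeMeasure T] f) (hG : G =ᵐ[timeMeasure T] g) : ip T f g = inner ℝ F G := by
  rw [L2.inner_def]
  refine integral_congr_ae ?_
  filter_upwards [hF, hG] with t h1 h2
  rw [h1, h2]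

variable {T : ℝ} {ψ χ : ℝ → H}

theorem IsTest.deriv (h : IsTest T ψ) : IsTest T (deriv ψ) :=
  ⟨(contDiff_infty_iff_deriv.mp h.1).2, h.2.1.deriv, tsupport_deriv_subset.trans h.2.2⟩

theorem IsTest.sub (h : IsTest T ψ) (h' : IsTest T χ) : IsTest T (ψ - χ) :=
  ⟨h.1.sub h'.1, h.2.1.sub h'.2.1, (tsupport_sub _ _).trans (union_subset h.2.2 h'.2.2)⟩

theorem IsTest.add (h : IsTest T ψ) (h' : IsTest T χ) : IsTest T (ψ + χ) :=
  ⟨h.1.add h'.1, h.2.1.add h'.2.1, (tsupport_add _ _).trans (union_subset h.2.2 h'.2.2)⟩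

theorem IsTest.const_smul (h : IsTest T ψ) (c : ℝ) : IsTest T (c • ψ) :=
  ⟨contDiff_const.smul h.1, h.2.1.smul_left (f := fun _ => c),
    (tsupport_smul_subset_right (fun _ => c) ψ).trans h.2.2⟩

theorem isTest_zero (T : ℝ) : IsTest T (0 : ℝ → H) :=
  ⟨contDiff_const, HasCompactSupport.zero, by simp [tsupport_zero]⟩

theorem IsTest.smul_const {η : ℝ → ℝ} (h : IsTest T η) (c : H) : IsTest T (fun t => η t • c) :=
  ⟨h.1.smul contDiff_const, h.2.1.smul_right,
    (tsupport_smul_subset_left η (fun _ => c)).trans h.2.2⟩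

theorem IsTest.memLp (h : IsTest T ψ) : MemLp ψ 2 (timeMeasure T) :=
  (h.1.continuous.memLp_of_hasCompactSupport h.2.1 (p := 2) (μ := volume)).mono_measure
    (timeMeasure_le T)

theorem IsTest.integrable (h : IsTest T ψ) : Integrable ψ :=
  h.1.continuous.integrable_of_hasCompactSupport h.2.1

/-- A test function as an element of `L²(I; H)`. -/
def IsTest.toLp (h : IsTest T ψ) : Lp H 2 (timeMeasure T) := h.memLp.toLp ψ

theorem IsTest.toLp_ae_eq (h : IsTest T ψ) : h.toLp =ᵐ[timeMeasure T] ψ := h.memLp.coeFn_toLp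

theorem IsTest.eq_zero_of_notMem (h : IsTest T ψ) {t : ℝ} (ht : t ∉ Ioo 0 T) : ψ t = 0 :=
  image_eq_zero_of_notMem_tsupport fun h' => ht (h.2.2 h')

theorem IsTest.differentiable (h : IsTest T ψ) : Differentiable ℝ ψ :=
  h.1.differentiable (by simp)

theorem exists_Icc_of_isTest (hT : 0 < T) (h : IsTest T ψ) :
    ∃ p q, 0 < p ∧ p ≤ q ∧ q < T ∧ ∀ t, t ∉ Icc p q → ψ t = 0 := by
  -- The point T / 2 keeps the set nonempty when ψ = 0.
  have hK : IsCompact (insert (T / 2) (tsupport ψ)) := h.2.1.insert _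
  have hne : (insert (T / 2) (tsupport ψ)).Nonempty := insert_nonempty _ _
  have hsub : insert (T / 2) (tsupport ψ) ⊆ Ioo 0 T :=
    insert_subset ⟨by linarith, by linarith⟩ h.2.2
  refine ⟨sInf (insert (T / 2) (tsupport ψ)), sSup (insert (T / 2) (tsupport ψ)),
    (hsub (hK.sInf_mem hne)).1, csInf_le_csSup hne hK.bddBelow hK.bddAbove,
    (hsub (hK.sSup_mem hne)).2, fun t ht => image_eq_zero_of_notMem_tsupport fun h' => ht ?_⟩
  exact ⟨csInf_le hK.bddBelow (mem_insert_of_mem _ h'), le_csSup hK.bddAbove (mem_insert_of_mem _ h')⟩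

theorem integral_timeMeasure_of_eq_zero {E : Type*} [NormedAddCommGroup E] [NormedSpace ℝ E]
    {f : ℝ → E} (hf : ∀ t, t ∉ Ioo 0 T → f t = 0) : ∫ t, f t ∂(timeMeasure T) = ∫ t, f t :=
  setIntegral_eq_integral_of_forall_compl_eq_zero hf

variable [CompleteSpace H]

theorem eq_zero_of_ip_isTest_eq_zero {f : Lp H 2 (timeMeasure T)}
    (hf : ∀ ψ : ℝ → H, IsTest T ψ → ip T f ψ = 0) : f = 0 := by
  have hfi := integrable_of_memLp_two (Lp.memLp f)
  have h : ∀ᵐ x, x ∈ Ioo 0 T → f x = 0 := by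
    refine isOpen_Ioo.ae_eq_zero_of_integral_contDiff_smul_eq_zero
      (IntegrableOn.locallyIntegrableOn hfi) fun η h1 h2 h3 => ?_
    have hη : IsTest T η := ⟨h1, h2, h3⟩
    rw [← integral_timeMeasure_of_eq_zero (T := T) fun t ht => by
      rw [hη.eq_zero_of_notMem ht, zero_smul]]
    refine ext_inner_left ℝ fun c => ?_
    have hb : Integrable (fun t => η t • f t) (timeMeasure T) := by
      obtain ⟨C, hC⟩ := hη.1.continuous.bounded_above_of_compact_support h2
      exact hfi.bdd_smul C hη.1.continuous.aestronglyMeasurable (Eventually.of_forall hC)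
    rw [← integral_inner hb, inner_zero_right, ← hf _ (hη.smul_const c)]
    refine integral_congr_ae (Eventually.of_forall fun t => ?_)
    simp only [inner_smul_right, real_inner_comm]
  refine Lp.ext ?_
  filter_upwards [(ae_restrict_iff' measurableSet_Ioo).mpr h, Lp.coeFn_zero H 2 (timeMeasure T)]
    with t h1 h2
  rw [h1, h2]
  rfl

theorem eq_of_ip_isTest_eq {f g : Lp H 2 (timeMeasure T)}
    (hfg : ∀ ψ (hψ : IsTest T ψ), inner ℝ f hψ.toLp = inner ℝ g hψ.toLp) : f = g := by
  rw [← sub_eq_zero]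
  refine eq_zero_of_ip_isTest_eq_zero fun ψ hψ => ?_
  rw [ip_eq_inner EventuallyEq.rfl hψ.toLp_ae_eq, inner_sub_left, hfg ψ hψ, sub_self]

theorem integral_zero_deriv (h : IsTest T ψ) (t : ℝ) : ∫ s in (0 : ℝ)..t, deriv ψ s = ψ t := by
  rw [intervalIntegral.integral_deriv_eq_sub (fun x _ => h.differentiable x)
    (h.deriv.1.continuous.intervalIntegrable _ _), h.eq_zero_of_notMem (t := 0) (by simp), sub_zero]

theorem fracInt_one_deriv (h : IsTest T ψ) : fracInt T 1 h.deriv.toLp = h.toLp := by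
  refine Lp.ext ?_
  filter_upwards [fracInt_ae_eq one_pos h.deriv.toLp_ae_eq, h.toLp_ae_eq] with t h1 h2
  rw [h1, h2, rlIntLeft]
  simp [integral_zero_deriv h]

theorem fracIntRight_one_deriv (h : IsTest T ψ) : fracIntRight T 1 h.deriv.toLp = -h.toLp := by
  refine Lp.ext ?_
  filter_upwards [fracIntRight_ae_eq one_pos h.deriv.toLp_ae_eq, h.toLp_ae_eq,
    Lp.coeFn_neg h.toLp] with t h1 h2 h3
  rw [h1, h3, Pi.neg_apply, h2, rlIntRight]
  simp only [Real.Gamma_one, inv_one, sub_self, Real.rpow_zero, one_smul]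
  rw [intervalIntegral.integral_deriv_eq_sub (fun x _ => h.differentiable x)
    (h.deriv.1.continuous.intervalIntegrable _ _), h.eq_zero_of_notMem (t := T) (by simp), zero_sub]

theorem exists_isTest_integral_eq_one (hT : 0 < T) :
    ∃ η : ℝ → ℝ, IsTest T η ∧ ∫ t, η t = 1 := by
  let b : ContDiffBump (T / 2) := ⟨T / 8, T / 4, by linarith, by linarith⟩
  refine ⟨b.normed volume, ⟨b.contDiff_normed, b.hasCompactSupport_normed, ?_⟩, b.integral_normed⟩
  rw [b.tsupport_normed_eq, Real.closedBall_eq_Icc]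
  intro x hx
  constructor <;> simp only [b] at hx <;> linarith [hx.1, hx.2]

/-- The primitive from 0 is the candidate; the vanishing mean is what makes it zero to the right of
the support. -/
theorem exists_isTest_deriv_eq (hT : 0 < T) (h : IsTest T ψ) (h0 : ∫ t, ψ t = 0) :
    ∃ θ : ℝ → H, IsTest T θ ∧ deriv θ = ψ := by
  obtain ⟨p, q, hp, hpq, hq, hψ⟩ := exists_Icc_of_isTest hT h
  have hd : ∀ t, HasDerivAt (fun t => ∫ s in (0 : ℝ)..t, ψ s) (ψ t) t := fun t =>
    intervalIntegral.integral_hasDerivAt_right (h.1.continuous.intervalIntegrable _ _)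
      h.1.continuous.stronglyMeasurable.stronglyMeasurableAtFilter h.1.continuous.continuousAt
  have hdeq : deriv (fun t => ∫ s in (0 : ℝ)..t, ψ s) = ψ := funext fun t => (hd t).deriv
  have hz : ∀ t, t ∉ Icc p q → ∫ s in (0 : ℝ)..t, ψ s = 0 := by
    intro t ht
    rw [mem_Icc, not_and_or, not_le, not_le] at ht
    rcases ht with ht | ht
    · refine intervalIntegral.integral_zero_ae (Eventually.of_forall fun s hs => hψ s fun h' => ?_)
      have := hs.2
      rcases le_total 0 t with h0 | h0
      · rw [max_eq_right h0] at this
        linarith [h'.1]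
      · rw [max_eq_left h0] at this
        linarith [h'.1]
    · rw [← h0, intervalIntegral.integral_of_le (by linarith)]
      refine setIntegral_eq_integral_of_forall_compl_eq_zero fun s hs => hψ s fun h' => hs ?_
      exact ⟨by linarith [h'.1], by linarith [h'.2]⟩
  have hts : tsupport (fun t => ∫ s in (0 : ℝ)..t, ψ s) ⊆ Icc p q :=
    closure_minimal (fun t ht => by_contra fun h' => ht (hz t h')) isClosed_Icc
  refine ⟨_, ⟨?_, ?_, ?_⟩, hdeq⟩
  · rw [contDiff_infty_iff_deriv, hdeq]
    exact ⟨fun t => (hd t).differentiableAt, h.1⟩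
  · exact HasCompactSupport.of_support_subset_isCompact isCompact_Icc
      ((subset_tsupport _).trans hts)
  · exact hts.trans (Icc_subset_Ioo hp hq)

/-- The lemma of du Bois-Reymond in `L²(I; H)`. -/
theorem exists_eq_const_of_inner_deriv_eq_zero (hT : 0 < T) {f : Lp H 2 (timeMeasure T)}
    (hf : ∀ ψ (hψ : IsTest T ψ), inner ℝ f hψ.deriv.toLp = 0) :
    ∃ c : H, f = Lp.const 2 (timeMeasure T) c := by
  obtain ⟨η, hη, hη1⟩ := exists_isTest_integral_eq_one hT
  have hfi := integrable_of_memLp_two (Lp.memLp f)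
  have hb : Integrable (fun t => η t • f t) (timeMeasure T) := by
    obtain ⟨C, hC⟩ := hη.1.continuous.bounded_above_of_compact_support hη.2.1
    exact hfi.bdd_smul C hη.1.continuous.aestronglyMeasurable (Eventually.of_forall hC)
  refine ⟨∫ t, η t • f t ∂(timeMeasure T), eq_of_ip_isTest_eq fun ψ hψ => ?_⟩
  set c := ∫ t, η t • f t ∂(timeMeasure T) with hc
  -- Subtracting η times the mean of ψ leaves mean zero, hence a derivative of a test function.
  have hηJ := hη.smul_const (∫ t, ψ t)
  obtain ⟨θ, hθ, hθ'⟩ := exists_isTest_deriv_eq hT (hψ.sub hηJ) (by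
    simp only [Pi.sub_apply]
    rw [integral_sub hψ.integrable hηJ.integrable, integral_smul_const, hη1, one_smul, sub_self])
  have h1 := hf θ hθ
  have h2 : hθ.deriv.toLp = hψ.toLp - hηJ.toLp := by
    refine Lp.ext ?_
    filter_upwards [hθ.deriv.toLp_ae_eq, hψ.toLp_ae_eq, hηJ.toLp_ae_eq,
      Lp.coeFn_sub hψ.toLp hηJ.toLp] with t h1 h2 h3 h4
    rw [h1, h4, Pi.sub_apply, h2, h3, hθ', Pi.sub_apply]
  rw [h2, inner_sub_right, sub_eq_zero] at h1
  rw [h1, ← ip_eq_inner EventuallyEq.rfl hηJ.toLp_ae_eq,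
    ← ip_eq_inner (Lp.coeFn_const _ _ _) hψ.toLp_ae_eq]
  have h3 : ip T f (fun t => η t • ∫ t, ψ t) = inner ℝ (∫ t, ψ t) c := by
    rw [hc, ← integral_inner hb]
    refine integral_congr_ae (Eventually.of_forall fun t => ?_)
    simp only [inner_smul_right, real_inner_comm]
  rw [h3, real_inner_comm]
  simp only [ip, Function.const_apply]
  rw [integral_inner (hψ.integrable.mono_measure (timeMeasure_le T)),
    integral_timeMeasure_of_eq_zero fun t ht => hψ.eq_zero_of_notMem ht]

/-- Each test function lies in the range of the adjoint, being minus the right integral of its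
derivative. -/
theorem fracInt_one_injective {f : Lp H 2 (timeMeasure T)} (hf : fracInt T 1 f = 0) : f = 0 := by
  refine eq_of_ip_isTest_eq fun ψ hψ => ?_
  rw [inner_zero_left, ← neg_eq_zero, ← inner_neg_right, ← fracIntRight_one_deriv,
    ← inner_fracInt_left, hf, inner_zero_left]

theorem fracIntRight_one_injective {f : Lp H 2 (timeMeasure T)} (hf : fracIntRight T 1 f = 0) :
    f = 0 := by
  refine eq_of_ip_isTest_eq fun ψ hψ => ?_
  rw [inner_zero_left, ← fracInt_one_deriv, inner_fracInt_right, hf, inner_zero_left]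

end Test

/-! ### Integrals of constants, endpoint bounds, measurability in the order -/

section Constants

variable {H : Type*} [NormedAddCommGroup H] [InnerProductSpace ℝ H] [CompleteSpace H]

theorem fracInt_const {T σ : ℝ} (hσ : 0 < σ) (c : H) :
    fracInt T σ (Lp.const 2 (timeMeasure T) c) =ᵐ[timeMeasure T]
      fun t => (t ^ σ / Real.Gamma (σ + 1)) • c := by
  filter_upwards [fracInt_ae_eq hσ (Lp.coeFn_const 2 (timeMeasure T) c), ae_mem_timeMeasure T]
    with t h1 ht
  rw [h1, rlIntLeft]
  simp only [Function.const_apply]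
  rw [intervalIntegral.integral_smul_const,
    intervalIntegral.integral_comp_sub_left (fun x => x ^ (σ - 1)) t, sub_self, sub_zero,
    integral_rpow (Or.inl (by linarith)), smul_smul, Real.Gamma_add_one hσ.ne', sub_add_cancel,
    Real.zero_rpow hσ.ne', sub_zero]
  congr 1
  field_simp

theorem fracIntRight_const {T σ : ℝ} (hσ : 0 < σ) (c : H) :
    fracIntRight T σ (Lp.const 2 (timeMeasure T) c) =ᵐ[timeMeasure T]
      fun t => ((T - t) ^ σ / Real.Gamma (σ + 1)) • c := by
  filter_upwards [fracIntRight_ae_eq hσ (Lp.coeFn_const 2 (timeMeasure T) c), ae_mem_timeMeasure T]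
    with t h1 ht
  rw [h1, rlIntRight]
  simp only [Function.const_apply]
  rw [intervalIntegral.integral_smul_const,
    intervalIntegral.integral_comp_sub_right (fun x => x ^ (σ - 1)) t, sub_self,
    integral_rpow (Or.inl (by linarith)), smul_smul, Real.Gamma_add_one hσ.ne', sub_add_cancel,
    Real.zero_rpow hσ.ne', sub_zero]
  congr 1
  field_simp

omit [CompleteSpace H] in
theorem integral_mul_norm_le {T : ℝ} {k : ℝ → ℝ} (hk : MemLp k 2 (timeMeasure T))
    (f : Lp H 2 (timeMeasure T)) :
    ∫ t, |k t| * ‖f t‖ ∂(timeMeasure T) ≤ √(∫ t, k t ^ 2 ∂(timeMeasure T)) * ‖f‖ := by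
  have h := integral_mul_le_Lp_mul_Lq_of_nonneg (μ := timeMeasure T) (f := fun t => |k t|)
    (g := fun t => ‖f t‖) Real.HolderConjugate.two_two
    (Eventually.of_forall fun _ => abs_nonneg _) (Eventually.of_forall fun _ => norm_nonneg _)
    (by simpa using hk.norm) (by simpa using (Lp.memLp f).norm)
  refine h.trans (le_of_eq ?_)
  have h2 : ∫ t, ‖f t‖ ^ 2 ∂(timeMeasure T) = ‖f‖ ^ 2 := by
    rw [← real_inner_self_eq_norm_sq f, L2.inner_def]
    simp
  simp only [Real.rpow_two, sq_abs, h2]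
  rw [← Real.sqrt_eq_rpow, ← Real.sqrt_eq_rpow, Real.sqrt_sq (norm_nonneg _)]

omit [CompleteSpace H] in
theorem norm_integral_smul_le {T : ℝ} {k : ℝ → ℝ} (hk : MemLp k 2 (timeMeasure T))
    (f : Lp H 2 (timeMeasure T)) :
    ‖∫ t, k t • f t ∂(timeMeasure T)‖ ≤ √(∫ t, k t ^ 2 ∂(timeMeasure T)) * ‖f‖ := by
  refine (norm_integral_le_integral_norm _).trans (le_trans (le_of_eq ?_) (integral_mul_norm_le hk f))
  simp [norm_smul]

/-- Cauchy-Schwarz on (0, t), where the kernel is bounded because σ ≥ 1. For σ = τ + 1 the rate t^{τ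
+ 1/2} is o(t^τ), which is what separates J^{τ+1} G from J^τ c. -/
theorem norm_fracInt_le {T σ : ℝ} (hσ : 1 ≤ σ) (f : Lp H 2 (timeMeasure T)) :
    ∀ᵐ t ∂(timeMeasure T), ‖fracInt T σ f t‖ ≤ (Real.Gamma σ)⁻¹ * t ^ (σ - 1) * √t * ‖f‖ := by
  have hσ0 : 0 < σ := by linarith
  have hΓ := Real.Gamma_pos_of_pos hσ0
  filter_upwards [fracInt_ae_eq_kernel hσ0 f, ae_mem_timeMeasure T] with t h1 ht
  rw [h1]
  have hpt (s : ℝ) (hs : s ∈ Ioo 0 T) : ‖rlKernel T σ (t - s)‖ ≤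
      (Ioo 0 t).indicator (fun _ => (Real.Gamma σ)⁻¹ * t ^ (σ - 1)) s := by
    rw [Real.norm_of_nonneg (rlKernel_nonneg hσ0 _)]
    by_cases h : s < t
    · rw [indicator_of_mem (show s ∈ Ioo 0 t from ⟨hs.1, h⟩),
        rlKernel_of_mem ⟨by linarith, by linarith [ht.2, hs.1]⟩]
      have : (t - s) ^ (σ - 1) ≤ t ^ (σ - 1) :=
        Real.rpow_le_rpow (by linarith) (by linarith [hs.1]) (by linarith)
      gcongr
    · rw [indicator_of_notMem (fun h' => h h'.2), rlKernel_of_notMem fun h' => h (by linarith [h'.1])]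
  have hind : MemLp ((Ioo 0 t).indicator fun _ => (Real.Gamma σ)⁻¹ * t ^ (σ - 1)) 2
      (timeMeasure T) := (memLp_const _).indicator measurableSet_Ioo
  have hk : MemLp (fun s => rlKernel T σ (t - s)) 2 (timeMeasure T) := by
    refine hind.mono' ((measurable_rlKernel T σ).comp (measurable_const.sub
      measurable_id)).aestronglyMeasurable ?_
    filter_upwards [ae_mem_timeMeasure T] with s hs using hpt s hs
  refine (norm_integral_smul_le hk f).trans (mul_le_mul_of_nonneg_right ?_ (norm_nonneg _))
  have hC : 0 ≤ (Real.Gamma σ)⁻¹ * t ^ (σ - 1) := by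
    have := Real.rpow_nonneg ht.1.le (σ - 1)
    positivity
  rw [← Real.sqrt_sq hC, ← Real.sqrt_mul (sq_nonneg _)]
  refine Real.sqrt_le_sqrt ?_
  calc ∫ s, rlKernel T σ (t - s) ^ 2 ∂(timeMeasure T)
      ≤ ∫ s, (Ioo 0 t).indicator (fun _ => ((Real.Gamma σ)⁻¹ * t ^ (σ - 1)) ^ 2) s
          ∂(timeMeasure T) := by
        refine integral_mono_of_nonneg (Eventually.of_forall fun _ => sq_nonneg _)
          ((integrable_const _).indicator measurableSet_Ioo) ?_
        filter_upwards [ae_mem_timeMeasure T] with s hs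
        have := hpt s hs
        by_cases h : s ∈ Ioo 0 t
        · rw [indicator_of_mem h] at this ⊢
          rw [← sq_abs]
          exact pow_le_pow_left₀ (abs_nonneg _) this 2
        · rw [indicator_of_notMem h] at this ⊢
          rw [norm_le_zero_iff.mp this]
          simp
    _ = _ := by
        rw [timeMeasure, setIntegral_indicator measurableSet_Ioo,
          inter_eq_right.mpr (Ioo_subset_Ioo le_rfl ht.2.le), setIntegral_const]
        simp [ht.1.le, mul_comm]

theorem norm_fracIntRight_one_le {T : ℝ} (f : Lp H 2 (timeMeasure T)) :
    ∀ᵐ t ∂(timeMeasure T), ‖fracIntRight T 1 f t‖ ≤ √(T - t) * ‖f‖ := by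
  filter_upwards [fracIntRight_ae_eq_kernel one_pos f, ae_mem_timeMeasure T] with t h1 ht
  rw [h1]
  have hpt (s : ℝ) (hs : s ∈ Ioo 0 T) : rlKernel T 1 (s - t) =
      (Ioo t T).indicator (fun _ => 1) s := by
    by_cases h : t < s
    · rw [indicator_of_mem (show s ∈ Ioo t T from ⟨h, hs.2⟩),
        rlKernel_of_mem ⟨by linarith, by linarith [ht.1, hs.2]⟩]
      simp
    · rw [indicator_of_notMem (fun h' => h h'.1), rlKernel_of_notMem fun h' => h (by linarith [h'.1])]
  have hind : MemLp ((Ioo t T).indicator fun _ => (1 : ℝ)) 2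
      (timeMeasure T) := (memLp_const _).indicator measurableSet_Ioo
  have heq : ∫ s, rlKernel T 1 (s - t) • f s ∂(timeMeasure T) =
      ∫ s, (Ioo t T).indicator (fun _ => (1 : ℝ)) s • f s ∂(timeMeasure T) := by
    refine integral_congr_ae ?_
    filter_upwards [ae_mem_timeMeasure T] with s hs
    rw [hpt s hs]
  rw [heq]
  refine (norm_integral_smul_le hind f).trans (mul_le_mul_of_nonneg_right ?_ (norm_nonneg _))
  refine Real.sqrt_le_sqrt (le_of_eq ?_)
  have : (fun s => (Ioo t T).indicator (fun _ => (1 : ℝ)) s ^ 2) =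
      (Ioo t T).indicator fun _ => (1 : ℝ) := by
    ext s
    by_cases h : s ∈ Ioo t T <;> simp [h]
  rw [this, timeMeasure, setIntegral_indicator measurableSet_Ioo,
    inter_eq_right.mpr (Ioo_subset_Ioo ht.1.le le_rfl), setIntegral_const]
  simp [ht.2.le]

/-- Once the gamma factor, continuous in τ, is taken out, the form is an integral of a jointly
measurable function of τ and the two times. -/
theorem measurable_inner_fracInt {T τ₀ τ₁ : ℝ} (h₁ : τ₁ < 1) (f g : Lp H 2 (timeMeasure T)) :
    AEMeasurable (fun τ => (inner ℝ (fracInt T (1 - τ) f) g : ℝ))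
      (volume.restrict (Icc τ₀ τ₁)) := by
  have heq : ∀ τ ∈ Icc τ₀ τ₁, (Real.Gamma (1 - τ))⁻¹ *
      (∫ p : ℝ × ℝ, (Ioo 0 T).indicator (fun x => x ^ (-τ)) (p.2 - p.1) *
        inner ℝ (f p.1) (g p.2) ∂((timeMeasure T).prod (timeMeasure T))) =
      inner ℝ (fracInt T (1 - τ) f) g := by
    intro τ hτ
    rw [inner_fracInt (by linarith [hτ.2]), kernelForm, ← integral_const_mul]
    refine integral_congr_ae (Eventually.of_forall fun p => ?_)
    simp only
    rw [← mul_assoc]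
    congr 1
    by_cases h : p.2 - p.1 ∈ Ioo 0 T
    · rw [indicator_of_mem h, rlKernel_of_mem h]
      congr 2
      ring
    · rw [indicator_of_notMem h, rlKernel_of_notMem h, mul_zero]
  refine AEMeasurable.congr ?_ ((ae_restrict_mem measurableSet_Icc).mono heq)
  refine AEMeasurable.mul ?_ ?_
  · refine ContinuousOn.aemeasurable (fun τ hτ => ContinuousAt.continuousWithinAt ?_)
      measurableSet_Icc
    have hpos : 0 < 1 - τ := by linarith [hτ.2]
    have h1 : ContinuousAt Real.Gamma (1 - τ) :=
      (Real.differentiableAt_Gamma fun m => by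
        have : (0 : ℝ) ≤ m := Nat.cast_nonneg m
        linarith).continuousAt
    exact ContinuousAt.inv₀ (ContinuousAt.comp (f := fun τ : ℝ => 1 - τ) h1 (by fun_prop))
      (Real.Gamma_pos_of_pos hpos).ne'
  · have hm : Measurable fun z : ℝ × ℝ × ℝ =>
        (Ioo 0 T).indicator (fun x => x ^ (-z.1)) (z.2.2 - z.2.1) := by
      have hd : Measurable fun z : ℝ × ℝ × ℝ => z.2.2 - z.2.1 := by fun_prop
      have : (fun z : ℝ × ℝ × ℝ => (Ioo 0 T).indicator (fun x => x ^ (-z.1)) (z.2.2 - z.2.1)) =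
          ((fun z : ℝ × ℝ × ℝ => z.2.2 - z.2.1) ⁻¹' (Ioo 0 T)).indicator
            fun z => (z.2.2 - z.2.1) ^ (-z.1) := by
        ext z
        simp [indicator]
      rw [this]
      exact (hd.pow measurable_fst.neg).indicator (hd measurableSet_Ioo)
    have hF : AEStronglyMeasurable (fun z : ℝ × ℝ × ℝ =>
        (Ioo 0 T).indicator (fun x => x ^ (-z.1)) (z.2.2 - z.2.1) *
          (inner ℝ (f z.2.1) (g z.2.2) : ℝ))
        ((volume.restrict (Icc τ₀ τ₁)).prod ((timeMeasure T).prod (timeMeasure T))) :=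
      hm.aestronglyMeasurable.mul
        (aestronglyMeasurable_inner_prod (Lp.memLp f).1 (Lp.memLp g).1).comp_snd
    exact hF.integral_prod_right'.aemeasurable

end Constants

/-! ### One-sided limits up to null sets -/

section NullSets

theorem neBot_nhdsWithin_inf_ae {S : Set ℝ} {x : ℝ} (hS : IsOpen S) (hx : x ∈ closure S) :
    (𝓝[S] x ⊓ ae volume).NeBot := by
  rw [inf_neBot_iff]
  intro A hA B hB
  obtain ⟨W, hW, hWx, hWA⟩ := mem_nhdsWithin.mp hA
  have hpos : 0 < volume (W ∩ S) :=
    (hW.inter hS).measure_pos _ (mem_closure_iff.mp hx W hW hWx)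
  by_contra h
  rw [not_nonempty_iff_eq_empty] at h
  have hsub : W ∩ S ⊆ Bᶜ := fun y hy hyB => by
    have : y ∈ A ∩ B := ⟨hWA hy, hyB⟩
    rw [h] at this
    exact this
  exact hpos.ne' (measure_mono_null hsub (mem_ae_iff.mp hB))

instance (x : ℝ) : (𝓝[>] x ⊓ ae volume).NeBot :=
  neBot_nhdsWithin_inf_ae isOpen_Ioi (by simp)

instance (x : ℝ) : (𝓝[<] x ⊓ ae volume).NeBot :=
  neBot_nhdsWithin_inf_ae isOpen_Iio (by simp)

theorem eventually_nhdsGT_inf_ae {T : ℝ} (hT : 0 < T) {P : ℝ → Prop}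
    (h : ∀ᵐ t ∂(timeMeasure T), P t) : ∀ᶠ t in 𝓝[>] 0 ⊓ ae volume, t ∈ Ioo 0 T ∧ P t := by
  have h1 := (ae_restrict_iff' measurableSet_Ioo).mp h
  have h2 : ∀ᶠ t in 𝓝[>] (0 : ℝ), t ∈ Ioo 0 T := Ioo_mem_nhdsGT hT
  filter_upwards [h2.filter_mono inf_le_left, h1.filter_mono inf_le_right] with t ht h3
  exact ⟨ht, h3 ht⟩

theorem eventually_nhdsLT_inf_ae {T : ℝ} (hT : 0 < T) {P : ℝ → Prop}
    (h : ∀ᵐ t ∂(timeMeasure T), P t) : ∀ᶠ t in 𝓝[<] T ⊓ ae volume, t ∈ Ioo 0 T ∧ P t := by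
  have h1 := (ae_restrict_iff' measurableSet_Ioo).mp h
  have h2 : ∀ᶠ t in 𝓝[<] T, t ∈ Ioo 0 T := Ioo_mem_nhdsLT hT
  filter_upwards [h2.filter_mono inf_le_left, h1.filter_mono inf_le_right] with t ht h3
  exact ⟨ht, h3 ht⟩

end NullSets

/-! ### Functions with a derivative in L² as fractional integrals -/

section Representation

variable {H : Type*} [NormedAddCommGroup H] [InnerProductSpace ℝ H] [CompleteSpace H]
variable {T τ : ℝ}

theorem rlDistLeft_of_lt_one (h0 : 0 < τ) (h1 : τ < 1) {u : ℝ → H} {U : Lp H 2 (timeMeasure T)}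
    (hU : U =ᵐ[timeMeasure T] u) {ψ : ℝ → H} (hψ : IsTest T ψ) :
    rlDistLeft T τ u ψ = -inner ℝ (fracInt T (1 - τ) U) hψ.deriv.toLp := by
  have hc : ⌈τ⌉₊ = 1 := by rw [Nat.ceil_eq_iff one_ne_zero]; constructor <;> norm_num <;> linarith
  rw [rlDistLeft, hc, Nat.cast_one, iteratedDeriv_one,
    ip_eq_inner (fracInt_ae_eq (by linarith) hU) hψ.deriv.toLp_ae_eq]
  ring

theorem rlDistRight_of_lt_one (h0 : 0 < τ) (h1 : τ < 1) {u : ℝ → H} {U : Lp H 2 (timeMeasure T)}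
    (hU : U =ᵐ[timeMeasure T] u) {ψ : ℝ → H} (hψ : IsTest T ψ) :
    rlDistRight T τ u ψ = inner ℝ (fracIntRight T (1 - τ) U) hψ.deriv.toLp := by
  have hc : ⌈τ⌉₊ = 1 := by rw [Nat.ceil_eq_iff one_ne_zero]; constructor <;> norm_num <;> linarith
  rw [rlDistRight, hc, Nat.cast_one, iteratedDeriv_one,
    ip_eq_inner (fracIntRight_ae_eq (by linarith) hU) hψ.deriv.toLp_ae_eq]

theorem HasLeftDeriv.ae_eq {σ : ℝ} {u g g' : ℝ → H} (h : HasLeftDeriv T σ u g)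
    (h' : HasLeftDeriv T σ u g') : g =ᵐ[timeMeasure T] g' := by
  have : h.1.toLp g = h'.1.toLp g' := eq_of_ip_isTest_eq fun ψ hψ => by
    rw [← ip_eq_inner h.1.coeFn_toLp hψ.toLp_ae_eq, ← ip_eq_inner h'.1.coeFn_toLp hψ.toLp_ae_eq,
      h.2 ψ hψ, h'.2 ψ hψ]
  exact (MemLp.toLp_eq_toLp_iff _ _).mp this

omit [CompleteSpace H] in
theorem hasLeftDeriv_leftDeriv {σ : ℝ} {u g : ℝ → H} (h : HasLeftDeriv T σ u g) :
    HasLeftDeriv T σ u (leftDeriv T σ u) := by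
  have h' : ∃ g, HasLeftDeriv T σ u g := ⟨g, h⟩
  rw [leftDeriv, dif_pos h']
  exact h'.choose_spec

theorem HasRightDeriv.ae_eq {σ : ℝ} {u g g' : ℝ → H} (h : HasRightDeriv T σ u g)
    (h' : HasRightDeriv T σ u g') : g =ᵐ[timeMeasure T] g' := by
  have : h.1.toLp g = h'.1.toLp g' := eq_of_ip_isTest_eq fun ψ hψ => by
    rw [← ip_eq_inner h.1.coeFn_toLp hψ.toLp_ae_eq, ← ip_eq_inner h'.1.coeFn_toLp hψ.toLp_ae_eq,
      h.2 ψ hψ, h'.2 ψ hψ]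
  exact (MemLp.toLp_eq_toLp_iff _ _).mp this

omit [CompleteSpace H] in
theorem hasRightDeriv_rightDeriv {σ : ℝ} {u g : ℝ → H} (h : HasRightDeriv T σ u g) :
    HasRightDeriv T σ u (rightDeriv T σ u) := by
  have h' : ∃ g, HasRightDeriv T σ u g := ⟨g, h⟩
  rw [rightDeriv, dif_pos h']
  exact h'.choose_spec

/-- J^{1-τ} U and J^1 G have the same distributional derivative, so du Bois-Reymond's lemma applies
to their difference. -/
theorem exists_fracInt_eq_add_const (hT : 0 < T) (h0 : 0 < τ) (h1 : τ < 1) {u g : ℝ → H}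
    {U G : Lp H 2 (timeMeasure T)} (hU : U =ᵐ[timeMeasure T] u) (hG : G =ᵐ[timeMeasure T] g)
    (h : HasLeftDeriv T τ u g) :
    ∃ c : H, fracInt T (1 - τ) U = fracInt T 1 G + Lp.const 2 (timeMeasure T) c := by
  obtain ⟨c, hc⟩ := exists_eq_const_of_inner_deriv_eq_zero hT
    (f := fracInt T (1 - τ) U - fracInt T 1 G) fun ψ hψ => by
      have h2 := h.2 ψ hψ
      rw [ip_eq_inner hG hψ.toLp_ae_eq, rlDistLeft_of_lt_one h0 h1 hU hψ] at h2
      rw [inner_sub_left, inner_fracInt_left T 1, fracIntRight_one_deriv hψ, inner_neg_right, h2]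
      ring
  exact ⟨c, by rw [← hc]; abel⟩

theorem fracInt_one_eq_add (h0 : 0 < τ) (h1 : τ < 1) {U G C : Lp H 2 (timeMeasure T)}
    (h : fracInt T (1 - τ) U = fracInt T 1 G + C) :
    fracInt T 1 U = fracInt T (τ + 1) G + fracInt T τ C := by
  have := congrArg (fracInt T τ) h
  rwa [map_add, ← fracInt_add h0 (by linarith), ← fracInt_add h0 one_pos,
    add_sub_cancel] at this

/-- Divided by t^{τ₁}, the term with c₁ is constant in norm while all others tend to 0 as t → 0.
Only the constant of the smaller order is eliminated. -/
theorem const_eq_zero_of_two_orders (hT : 0 < T) {τ₁ τ₂ : ℝ} (h0 : 0 < τ₁) (h12 : τ₁ < τ₂)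
    {G₁ G₂ : Lp H 2 (timeMeasure T)} {c₁ c₂ : H}
    (h : fracInt T (τ₁ + 1) G₁ + fracInt T τ₁ (Lp.const 2 (timeMeasure T) c₁) =
      fracInt T (τ₂ + 1) G₂ + fracInt T τ₂ (Lp.const 2 (timeMeasure T) c₂)) : c₁ = 0 := by
  have h0' : 0 < τ₂ := h0.trans h12
  have hΓ₁ := Real.Gamma_pos_of_pos (show 0 < τ₁ + 1 by linarith)
  have hΓ₂ := Real.Gamma_pos_of_pos (show 0 < τ₂ + 1 by linarith)
  let F : ℝ → ℝ := fun t => (Real.Gamma (τ₁ + 1))⁻¹ * √t * ‖G₁‖ +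
    ((Real.Gamma (τ₂ + 1))⁻¹ * t ^ (τ₂ - τ₁) * √t * ‖G₂‖ +
      t ^ (τ₂ - τ₁) / Real.Gamma (τ₂ + 1) * ‖c₂‖)
  have hev : ∀ᵐ t ∂(timeMeasure T), t ∈ Ioo 0 T → ‖c₁‖ / Real.Gamma (τ₁ + 1) ≤ F t := by
    have hadd₁ := Lp.coeFn_add (fracInt T (τ₁ + 1) G₁)
      (fracInt T τ₁ (Lp.const 2 (timeMeasure T) c₁))
    rw [h] at hadd₁
    filter_upwards [hadd₁, Lp.coeFn_add (fracInt T (τ₂ + 1) G₂)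
      (fracInt T τ₂ (Lp.const 2 (timeMeasure T) c₂)), norm_fracInt_le (σ := τ₁ + 1) (by linarith) G₁,
      norm_fracInt_le (σ := τ₂ + 1) (by linarith) G₂, fracInt_const h0 c₁, fracInt_const h0' c₂]
      with t e1 e2 n1 n2 k1 k2 ht
    rw [e2, Pi.add_apply, Pi.add_apply, k1, k2] at e1
    rw [add_sub_cancel_right] at n1 n2
    have hp : 0 < t ^ τ₁ := Real.rpow_pos_of_pos ht.1 _
    have hsplit : t ^ τ₂ = t ^ (τ₂ - τ₁) * t ^ τ₁ := by
      rw [← Real.rpow_add ht.1, sub_add_cancel]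
    have hp2 : 0 < t ^ (τ₂ - τ₁) := Real.rpow_pos_of_pos ht.1 _
    have e3 : (t ^ τ₁ / Real.Gamma (τ₁ + 1)) • c₁ = fracInt T (τ₂ + 1) G₂ t +
        (t ^ τ₂ / Real.Gamma (τ₂ + 1)) • c₂ - fracInt T (τ₁ + 1) G₁ t := by
      rw [e1]; abel
    have e4 : ‖(t ^ τ₁ / Real.Gamma (τ₁ + 1)) • c₁‖ ≤ ‖fracInt T (τ₂ + 1) G₂ t‖ +
        ‖(t ^ τ₂ / Real.Gamma (τ₂ + 1)) • c₂‖ + ‖fracInt T (τ₁ + 1) G₁ t‖ := by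
      rw [e3]
      exact (norm_sub_le _ _).trans (add_le_add_left (norm_add_le _ _) _)
    rw [norm_smul, norm_smul, Real.norm_of_nonneg (by positivity), Real.norm_of_nonneg (by
      rw [hsplit]; positivity)] at e4
    refine le_of_mul_le_mul_right ?_ hp
    calc ‖c₁‖ / Real.Gamma (τ₁ + 1) * t ^ τ₁ = t ^ τ₁ / Real.Gamma (τ₁ + 1) * ‖c₁‖ := by ring
      _ ≤ _ := e4
      _ ≤ (Real.Gamma (τ₂ + 1))⁻¹ * t ^ τ₂ * √t * ‖G₂‖ + t ^ τ₂ / Real.Gamma (τ₂ + 1) * ‖c₂‖ +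
          (Real.Gamma (τ₁ + 1))⁻¹ * t ^ τ₁ * √t * ‖G₁‖ := by gcongr
      _ = F t * t ^ τ₁ := by rw [hsplit]; simp only [F]; ring
  have hF : Tendsto F (𝓝[>] 0 ⊓ ae volume) (𝓝 0) := by
    have hc : ContinuousAt F 0 := by
      have : ContinuousAt (fun t : ℝ => t ^ (τ₂ - τ₁)) 0 :=
        Real.continuousAt_rpow_const _ _ (Or.inr (by linarith))
      simp only [F]
      fun_prop
    have h00 : F 0 = 0 := by
      simp [F, Real.zero_rpow (sub_pos.mpr h12).ne']
    have := hc.tendsto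
    rw [h00] at this
    exact this.mono_left (inf_le_left.trans nhdsWithin_le_nhds)
  have hle := ge_of_tendsto hF
    ((eventually_nhdsGT_inf_ae hT hev).mono fun t ht => ht.2 ht.1)
  have : ‖c₁‖ / Real.Gamma (τ₁ + 1) * Real.Gamma (τ₁ + 1) ≤ 0 * Real.Gamma (τ₁ + 1) :=
    mul_le_mul_of_nonneg_right hle hΓ₁.le
  rw [div_mul_cancel₀ _ hΓ₁.ne', zero_mul] at this
  exact norm_le_zero_iff.mp this

theorem eq_fracInt_of_fracInt_one_eq (h0 : 0 < τ) {U G : Lp H 2 (timeMeasure T)}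
    (h : fracInt T 1 U = fracInt T (τ + 1) G) : U = fracInt T τ G := by
  rw [← sub_eq_zero]
  refine fracInt_one_injective ?_
  rw [map_sub, h, add_comm, fracInt_add one_pos h0, sub_self]

theorem hasLeftDeriv_of_eq_fracInt (h0 : 0 < τ) (h1 : τ < 1) {u g : ℝ → H}
    {U G : Lp H 2 (timeMeasure T)} (hU : U =ᵐ[timeMeasure T] u) (hG : G =ᵐ[timeMeasure T] g)
    (h : U = fracInt T τ G) : HasLeftDeriv T τ u g := by
  refine ⟨(memLp_congr_ae hG).mp (Lp.memLp G), fun ψ hψ => ?_⟩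
  rw [rlDistLeft_of_lt_one h0 h1 hU hψ, ip_eq_inner hG hψ.toLp_ae_eq, h,
    ← fracInt_add (by linarith) h0, sub_add_cancel, inner_fracInt_left, fracIntRight_one_deriv,
    inner_neg_right, neg_neg]

theorem hasRightDeriv_of_eq_fracIntRight (h0 : 0 < τ) (h1 : τ < 1) {u g : ℝ → H}
    {U G : Lp H 2 (timeMeasure T)} (hU : U =ᵐ[timeMeasure T] u) (hG : G =ᵐ[timeMeasure T] g)
    (h : U = fracIntRight T τ G) : HasRightDeriv T τ u g := by
  refine ⟨(memLp_congr_ae hG).mp (Lp.memLp G), fun ψ hψ => ?_⟩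
  rw [rlDistRight_of_lt_one h0 h1 hU hψ, ip_eq_inner hG hψ.toLp_ae_eq, h,
    ← fracIntRight_add (by linarith) h0, sub_add_cancel, ← inner_fracInt_right, fracInt_one_deriv]

end Representation

/-! ### Left and right derivatives of test functions -/

section TestDerivatives

variable {H : Type*} [NormedAddCommGroup H] [InnerProductSpace ℝ H] [CompleteSpace H]
variable {T : ℝ} {ψ χ : ℝ → H}

/-- The left derivative of order `τ` of a test function. -/
def IsTest.leftD (h : IsTest T ψ) (τ : ℝ) : Lp H 2 (timeMeasure T) :=
  fracInt T (1 - τ) h.deriv.toLp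

/-- The right derivative of order `τ` of a test function. -/
def IsTest.rightD (h : IsTest T ψ) (τ : ℝ) : Lp H 2 (timeMeasure T) :=
  -fracIntRight T (1 - τ) h.deriv.toLp

omit [CompleteSpace H] in
theorem IsTest.deriv_toLp_sub (h : IsTest T ψ) (h' : IsTest T χ) :
    (h.sub h').deriv.toLp = h.deriv.toLp - h'.deriv.toLp := by
  refine Lp.ext ?_
  filter_upwards [(h.sub h').deriv.toLp_ae_eq, h.deriv.toLp_ae_eq, h'.deriv.toLp_ae_eq,
    Lp.coeFn_sub h.deriv.toLp h'.deriv.toLp] with t h1 h2 h3 h4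
  rw [h1, h4, Pi.sub_apply, h2, h3]
  exact deriv_sub (h.differentiable t) (h'.differentiable t)

omit [CompleteSpace H] in
theorem IsTest.deriv_toLp_add (h : IsTest T ψ) (h' : IsTest T χ) :
    (h.add h').deriv.toLp = h.deriv.toLp + h'.deriv.toLp := by
  refine Lp.ext ?_
  filter_upwards [(h.add h').deriv.toLp_ae_eq, h.deriv.toLp_ae_eq, h'.deriv.toLp_ae_eq,
    Lp.coeFn_add h.deriv.toLp h'.deriv.toLp] with t h1 h2 h3 h4
  rw [h1, h4, Pi.add_apply, h2, h3]
  exact deriv_add (h.differentiable t) (h'.differentiable t)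

omit [CompleteSpace H] in
theorem IsTest.deriv_toLp_const_smul (h : IsTest T ψ) (c : ℝ) :
    (h.const_smul c).deriv.toLp = c • h.deriv.toLp := by
  refine Lp.ext ?_
  filter_upwards [(h.const_smul c).deriv.toLp_ae_eq, h.deriv.toLp_ae_eq,
    Lp.coeFn_smul c h.deriv.toLp] with t h1 h2 h4
  rw [h1, h4, Pi.smul_apply, h2]
  exact deriv_const_smul c (h.differentiable t)

omit [CompleteSpace H] in
theorem isTest_zero_deriv_toLp (T : ℝ) : (isTest_zero (H := H) T).deriv.toLp = 0 := by
  refine Lp.ext ?_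
  filter_upwards [(isTest_zero (H := H) T).deriv.toLp_ae_eq, Lp.coeFn_zero H 2 (timeMeasure T)]
    with t h1 h2
  rw [h1, h2]
  simp

variable {τ : ℝ}

theorem IsTest.leftD_sub (h : IsTest T ψ) (h' : IsTest T χ) :
    (h.sub h').leftD τ = h.leftD τ - h'.leftD τ := by
  rw [leftD, h.deriv_toLp_sub h', map_sub]; rfl

theorem IsTest.rightD_sub (h : IsTest T ψ) (h' : IsTest T χ) :
    (h.sub h').rightD τ = h.rightD τ - h'.rightD τ := by
  rw [rightD, h.deriv_toLp_sub h', map_sub, rightD, rightD]; abel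

theorem IsTest.fracInt_leftD (h : IsTest T ψ) (h0 : 0 < τ) (h1 : τ < 1) :
    fracInt T τ (h.leftD τ) = h.toLp := by
  rw [leftD, ← fracInt_add h0 (by linarith), add_sub_cancel, fracInt_one_deriv]

theorem IsTest.fracIntRight_rightD (h : IsTest T ψ) (h0 : 0 < τ) (h1 : τ < 1) :
    fracIntRight T τ (h.rightD τ) = h.toLp := by
  rw [rightD, map_neg, ← fracIntRight_add h0 (by linarith), add_sub_cancel, fracIntRight_one_deriv,
    neg_neg]

theorem IsTest.leftDeriv_ae_eq (h : IsTest T ψ) (h0 : 0 < τ) (h1 : τ < 1) :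
    leftDeriv T τ ψ =ᵐ[timeMeasure T] h.leftD τ := by
  have := hasLeftDeriv_of_eq_fracInt h0 h1 h.toLp_ae_eq (G := h.leftD τ) EventuallyEq.rfl
    (h.fracInt_leftD h0 h1).symm
  exact (hasLeftDeriv_leftDeriv this).ae_eq this

/-- With n = ⌈2τ⌉ the semigroup law gives J^{n-2τ} J^τ G = J^{n-τ} G. For n = 2 one full integral
cancels one derivative of ψ', so both cases end with J^{1-τ} G against ψ'. -/
theorem rlDistLeft_two_mul (h0 : 0 < τ) (h1 : τ < 1) (hτ : τ ≠ 1 / 2) {u : ℝ → H}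
    {U G : Lp H 2 (timeMeasure T)} (hU : U =ᵐ[timeMeasure T] u) (h : U = fracInt T τ G)
    (hψ : IsTest T ψ) : rlDistLeft T (2 * τ) u ψ = inner ℝ G (hψ.rightD τ) := by
  rcases lt_or_gt_of_ne hτ with hτ | hτ
  · rw [rlDistLeft_of_lt_one (by linarith) (by linarith) hU hψ, h,
      ← fracInt_add (by linarith) h0, show 1 - 2 * τ + τ = 1 - τ by ring, inner_fracInt_left,
      IsTest.rightD, inner_neg_right]
  · have hc : ⌈2 * τ⌉₊ = 2 := by
      rw [Nat.ceil_eq_iff two_ne_zero]; constructor <;> norm_num <;> linarith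
    rw [rlDistLeft, hc, Nat.cast_ofNat, iteratedDeriv_succ, iteratedDeriv_one,
      ip_eq_inner (fracInt_ae_eq (by linarith) hU) hψ.deriv.deriv.toLp_ae_eq, h,
      ← fracInt_add (by linarith) h0, show 2 - 2 * τ + τ = 1 + (1 - τ) by ring,
      fracInt_add one_pos (by linarith), inner_fracInt_left, fracIntRight_one_deriv hψ.deriv,
      inner_neg_right, inner_fracInt_left, IsTest.rightD, inner_neg_right]
    ring

theorem fracIntRight_injective (h0 : 0 < τ) (h1 : τ < 1) {f : Lp H 2 (timeMeasure T)}
    (hf : fracIntRight T τ f = 0) : f = 0 := by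
  refine fracIntRight_one_injective ?_
  rw [← sub_add_cancel 1 τ, fracIntRight_add (by linarith) h0, hf, map_zero]

theorem denseRange_fracInt (h0 : 0 < τ) (h1 : τ < 1) :
    DenseRange (fracInt (H := H) T τ) := by
  have : (LinearMap.range (fracInt (H := H) T τ).toLinearMap)ᗮ = ⊥ := by
    rw [Submodule.eq_bot_iff]
    intro f hf
    refine fracIntRight_injective h0 h1 (ext_inner_right ℝ fun g => ?_)
    rw [← inner_fracInt_right, inner_zero_left, real_inner_comm]
    exact (Submodule.mem_orthogonal _ _).mp hf _ ⟨g, rfl⟩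
  rw [← Submodule.topologicalClosure_eq_top_iff] at this
  rw [DenseRange, dense_iff_closure_eq]
  exact congrArg (fun K : Submodule ℝ _ => (K : Set (Lp H 2 (timeMeasure T)))) this

/-- For τ > 1/2 this is the comparison of integrals of order 1 - τ < 1/2, applied to ψ'. For τ < 1/2
it follows by duality: against J^τ y, the right derivative gives (ψ, y), which is the left
derivative against J*^τ y; the comparison of order τ applies to y, and the range of J^τ is dense. -/
theorem IsTest.norm_rightD_le (h : IsTest T ψ) (h0 : 0 < τ) (h1 : τ < 1) (hτ : τ ≠ 1 / 2) :
    |Real.cos (Real.pi * τ)| * ‖h.rightD τ‖ ≤ ‖h.leftD τ‖ := by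
  rcases lt_or_gt_of_ne hτ with hτ | hτ
  · have hcos : 0 ≤ Real.cos (Real.pi * τ) := Real.cos_nonneg_of_mem_Icc
      ⟨by nlinarith [Real.pi_pos], by nlinarith [Real.pi_pos]⟩
    rw [abs_of_nonneg hcos]
    have key : ∀ z, Real.cos (Real.pi * τ) * (inner ℝ (h.rightD τ) z : ℝ) ≤
        ‖h.leftD τ‖ * ‖z‖ := by
      intro z
      refine (denseRange_fracInt (H := H) (T := T) h0 h1).induction_on z ?_ fun y => ?_
      · exact isClosed_le (by fun_prop) (by fun_prop)
      · rw [inner_fracInt_right, h.fracIntRight_rightD h0 h1, ← h.fracInt_leftD h0 h1,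
          inner_fracInt_left]
        calc _ ≤ Real.cos (Real.pi * τ) * (‖h.leftD τ‖ * ‖fracIntRight T τ y‖) :=
              mul_le_mul_of_nonneg_left (real_inner_le_norm _ _) hcos
          _ = ‖h.leftD τ‖ * (Real.cos (Real.pi * τ) * ‖fracIntRight T τ y‖) := by ring
          _ ≤ _ := mul_le_mul_of_nonneg_left (cos_mul_norm_fracIntRight_le h0 hτ y) (norm_nonneg _)
    have h2 := key (h.rightD τ)
    rw [real_inner_self_eq_norm_sq] at h2
    rcases (norm_nonneg (h.rightD τ)).eq_or_lt with h3 | h3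
    · rw [← h3, mul_zero]; exact norm_nonneg _
    · nlinarith
  · have h2 := cos_mul_norm_fracIntRight_le (T := T) (a := 1 - τ) (by linarith) (by linarith)
      h.deriv.toLp
    have hcos : 0 ≤ Real.cos (Real.pi * (1 - τ)) := Real.cos_nonneg_of_mem_Icc
      ⟨by nlinarith [Real.pi_pos], by nlinarith [Real.pi_pos]⟩
    have h3 : Real.cos (Real.pi * (1 - τ)) = -Real.cos (Real.pi * τ) := by
      rw [← Real.cos_pi_sub]; ring_nf
    rw [h3] at h2 hcos
    rw [abs_of_nonpos (by linarith), rightD, norm_neg]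
    exact h2

end TestDerivatives

/-! ### Behaviour at t = T below and above order 1/2 -/

section EndValue

variable {H : Type*} [NormedAddCommGroup H] [InnerProductSpace ℝ H]
variable {T τ : ℝ}

theorem halfKernel_sub_eq_zero {s t : ℝ} (h : ¬s < t) : halfKernel τ (t - s) = 0 :=
  indicator_of_notMem (fun h' => h (sub_pos.mp h')) _

theorem rlIntLeft_eq_halfKernel {t : ℝ} (ht : t ∈ Ioc 0 T) (f : ℝ → H) :
    rlIntLeft τ f t = ∫ s, halfKernel τ (t - s) • f s ∂(timeMeasure T) := by
  have h : ∀ s ∈ Ioo 0 T, halfKernel τ (t - s) • f s =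
      (Ioo 0 t).indicator (fun s => (Real.Gamma τ)⁻¹ • (t - s) ^ (τ - 1) • f s) s := by
    intro s hs
    by_cases h : s < t
    · rw [indicator_of_mem (show s ∈ Ioo 0 t from ⟨hs.1, h⟩), halfKernel,
        indicator_of_mem (mem_Ioi.mpr (sub_pos.mpr h)), mul_smul]
    · rw [indicator_of_notMem (fun h' => h h'.2), halfKernel_sub_eq_zero h, zero_smul]
  rw [timeMeasure, setIntegral_congr_fun measurableSet_Ioo h, setIntegral_indicator measurableSet_Ioo,
    inter_eq_right.mpr (Ioo_subset_Ioo le_rfl ht.2), integral_smul, rlIntLeft,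
    intervalIntegral.integral_of_le ht.1.le, integral_Ioc_eq_integral_Ioo]

theorem halfKernel_sq (x : ℝ) : halfKernel τ x ^ 2 =
    (Ioi 0).indicator (fun x => (Real.Gamma τ)⁻¹ ^ 2 * x ^ (2 * τ - 1 - 1)) x := by
  by_cases h : 0 < x
  · rw [halfKernel, indicator_of_mem (mem_Ioi.mpr h), indicator_of_mem (mem_Ioi.mpr h), mul_pow,
      ← Real.rpow_mul_natCast h.le]
    congr 2
    push_cast
    ring
  · rw [halfKernel, indicator_of_notMem (mt mem_Ioi.mp h), indicator_of_notMem (mt mem_Ioi.mp h)]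
    simp

theorem intervalIntegrable_sub_rpow {σ : ℝ} (hσ : 0 < σ) (a b t : ℝ) :
    IntervalIntegrable (fun s => (t - s) ^ (σ - 1)) volume a b := by
  have := (intervalIntegral.intervalIntegrable_rpow' (a := t - a) (b := t - b) (r := σ - 1)
    (by linarith)).comp_sub_left t
  simpa using this

theorem integral_sub_rpow {σ : ℝ} (hσ : 0 < σ) (b t : ℝ) :
    ∫ s in (0 : ℝ)..b, (t - s) ^ (σ - 1) = (t ^ σ - (t - b) ^ σ) / σ := by
  rw [intervalIntegral.integral_comp_sub_left (fun x => x ^ (σ - 1)) t, sub_zero,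
    integral_rpow (Or.inl (by linarith)), sub_add_cancel]

theorem indicator_halfKernel_sq {b t : ℝ} (hbt : b ≤ t) (s : ℝ) :
    (Iio b).indicator (fun s => halfKernel τ (t - s) ^ 2) s =
      (Iio b).indicator (fun s => (Real.Gamma τ)⁻¹ ^ 2 * (t - s) ^ (2 * τ - 1 - 1)) s := by
  by_cases h : s < b
  · rw [indicator_of_mem (mem_Iio.mpr h), indicator_of_mem (mem_Iio.mpr h), halfKernel_sq,
      indicator_of_mem (mem_Ioi.mpr (by linarith))]
  · rw [indicator_of_notMem (mt mem_Iio.mp h), indicator_of_notMem (mt mem_Iio.mp h)]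

theorem integrable_indicator_halfKernel_sq (hτ : 1 / 2 < τ) {b t : ℝ} (hb : b ∈ Ioc 0 T)
    (hbt : b ≤ t) : Integrable ((Iio b).indicator fun s => halfKernel τ (t - s) ^ 2)
      (timeMeasure T) := by
  have h : ((Iio b).indicator fun s => halfKernel τ (t - s) ^ 2) =
      (Iio b).indicator (fun s => (Real.Gamma τ)⁻¹ ^ 2 * (t - s) ^ (2 * τ - 1 - 1)) :=
    funext (indicator_halfKernel_sq hbt)
  have h1 := (intervalIntegrable_sub_rpow (σ := 2 * τ - 1) (by linarith) 0 b t).const_mul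
    ((Real.Gamma τ)⁻¹ ^ 2)
  rw [intervalIntegrable_iff_integrableOn_Ioo_of_le hb.1.le] at h1
  rw [h, integrable_indicator_iff measurableSet_Iio, timeMeasure, IntegrableOn,
    Measure.restrict_restrict measurableSet_Iio]
  exact h1.mono_set fun s hs => ⟨hs.2.1, hs.1⟩

theorem integral_indicator_halfKernel_sq (hτ : 1 / 2 < τ) {b t : ℝ} (hb : b ∈ Ioc 0 T)
    (hbt : b ≤ t) :
    ∫ s, (Iio b).indicator (fun s => halfKernel τ (t - s) ^ 2) s ∂(timeMeasure T) =
      (Real.Gamma τ)⁻¹ ^ 2 * ((t ^ (2 * τ - 1) - (t - b) ^ (2 * τ - 1)) / (2 * τ - 1)) := by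
  simp only [indicator_halfKernel_sq hbt]
  rw [integral_indicator measurableSet_Iio, timeMeasure,
    Measure.restrict_restrict measurableSet_Iio, integral_const_mul,
    ← integral_sub_rpow (by linarith) b t, intervalIntegral.integral_of_le hb.1.le,
    integral_Ioc_eq_integral_Ioo]
  congr 3
  ext s
  simp only [mem_inter_iff, mem_Iio, mem_Ioo]
  constructor
  · rintro ⟨h1, h2, -⟩; exact ⟨h2, h1⟩
  · rintro ⟨h1, h2⟩; exact ⟨h2, h1, h2.trans_le hb.2⟩

theorem halfKernel_sq_eq_indicator (t s : ℝ) : halfKernel τ (t - s) ^ 2 =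
    (Iio t).indicator (fun s => halfKernel τ (t - s) ^ 2) s := by
  by_cases h : s < t
  · rw [indicator_of_mem (mem_Iio.mpr h)]
  · rw [indicator_of_notMem (mt mem_Iio.mp h), halfKernel_sub_eq_zero h]
    simp

theorem memLp_halfKernel (hτ : 1 / 2 < τ) {t : ℝ} (ht : t ∈ Ioc 0 T) :
    MemLp (fun s => halfKernel τ (t - s)) 2 (timeMeasure T) := by
  have hm : Measurable fun s => halfKernel τ (t - s) :=
    (measurable_halfKernel τ).comp (measurable_const.sub measurable_id)
  rw [memLp_two_iff_integrable_sq hm.aestronglyMeasurable]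
  exact (integrable_indicator_halfKernel_sq hτ ht le_rfl).congr
    (Eventually.of_forall fun s => (halfKernel_sq_eq_indicator t s).symm)

/-- As the kernel is decreasing, p = k(t-s) and q = k(T-s) satisfy p ≥ q ≥ 0 for s < t, so (p - q)²
≤ p² + q² - 2q². The three resulting integrals are elementary. -/
theorem integral_halfKernel_sub_sq_le (hτ : 1 / 2 < τ) (hτ1 : τ < 1) {t : ℝ} (ht : t ∈ Ioo 0 T) :
    ∫ s, (halfKernel τ (t - s) - halfKernel τ (T - s)) ^ 2 ∂(timeMeasure T) ≤
      (Real.Gamma τ)⁻¹ ^ 2 * ((t ^ (2 * τ - 1) - T ^ (2 * τ - 1) +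
        2 * (T - t) ^ (2 * τ - 1)) / (2 * τ - 1)) := by
  have htc : t ∈ Ioc 0 T := ⟨ht.1, ht.2.le⟩
  have hTc : T ∈ Ioc 0 T := ⟨ht.1.trans ht.2, le_rfl⟩
  have i1 := integrable_indicator_halfKernel_sq hτ htc le_rfl
  have i2 := integrable_indicator_halfKernel_sq hτ hTc le_rfl
  have i3 := (integrable_indicator_halfKernel_sq hτ htc ht.2.le).const_mul 2
  have i12 : Integrable (fun s => (Iio t).indicator (fun s => halfKernel τ (t - s) ^ 2) s +
      (Iio T).indicator (fun s => halfKernel τ (T - s) ^ 2) s) (timeMeasure T) := i1.add i2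
  have hτ0 : 0 < τ := by linarith
  have hle : ∀ s ∈ Ioo 0 T, (halfKernel τ (t - s) - halfKernel τ (T - s)) ^ 2 ≤
      (Iio t).indicator (fun s => halfKernel τ (t - s) ^ 2) s +
        (Iio T).indicator (fun s => halfKernel τ (T - s) ^ 2) s -
        2 * (Iio t).indicator (fun s => halfKernel τ (T - s) ^ 2) s := by
    intro s hs
    rw [← halfKernel_sq_eq_indicator, ← halfKernel_sq_eq_indicator]
    have hk1 := halfKernel_nonneg hτ0 (T - s)
    by_cases h : s < t
    · have hk : halfKernel τ (T - s) ≤ halfKernel τ (t - s) := by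
        rw [halfKernel, halfKernel, indicator_of_mem (mem_Ioi.mpr (sub_pos.mpr h)),
          indicator_of_mem (mem_Ioi.mpr (sub_pos.mpr hs.2))]
        refine mul_le_mul_of_nonneg_left ?_ (inv_nonneg.mpr (Real.Gamma_pos_of_pos hτ0).le)
        exact Real.rpow_le_rpow_of_nonpos (sub_pos.mpr h) (by linarith [ht.2]) (by linarith)
      rw [indicator_of_mem (mem_Iio.mpr h)]
      nlinarith
    · rw [indicator_of_notMem (mt mem_Iio.mp h), halfKernel_sub_eq_zero h]
      nlinarith
  calc _ ≤ ∫ s, ((Iio t).indicator (fun s => halfKernel τ (t - s) ^ 2) s +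
        (Iio T).indicator (fun s => halfKernel τ (T - s) ^ 2) s -
        2 * (Iio t).indicator (fun s => halfKernel τ (T - s) ^ 2) s) ∂(timeMeasure T) := by
        refine integral_mono_of_nonneg (Eventually.of_forall fun _ => sq_nonneg _)
          (i12.sub i3) ?_
        filter_upwards [ae_mem_timeMeasure T] with s hs using hle s hs
    _ = _ := by
        rw [integral_sub i12 i3, integral_add i1 i2, integral_const_mul,
          integral_indicator_halfKernel_sq hτ htc le_rfl,
          integral_indicator_halfKernel_sq hτ hTc le_rfl,
          integral_indicator_halfKernel_sq hτ htc ht.2.le, sub_self, sub_self,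
          Real.zero_rpow (by linarith)]
        ring

/-- The kernel is square integrable for τ > 1/2 and depends continuously on t in L² at t = T, so
Cauchy-Schwarz gives the endpoint value a meaning. -/
theorem tendsto_rlIntLeft_end (hT : 0 < T) (hτ : 1 / 2 < τ) (hτ1 : τ < 1)
    (f : Lp H 2 (timeMeasure T)) :
    Tendsto (rlIntLeft τ f) (𝓝[<] T) (𝓝 (rlIntLeft τ f T)) := by
  have hTc : T ∈ Ioc 0 T := ⟨hT, le_rfl⟩
  let F : ℝ → ℝ := fun t => √((Real.Gamma τ)⁻¹ ^ 2 * ((t ^ (2 * τ - 1) - T ^ (2 * τ - 1) +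
        2 * (T - t) ^ (2 * τ - 1)) / (2 * τ - 1))) * ‖f‖
  have hF : Tendsto F (𝓝[<] T) (𝓝 0) := by
    have hc : ContinuousAt F T := by
      have h1 : ContinuousAt (fun t : ℝ => t ^ (2 * τ - 1)) T :=
        Real.continuousAt_rpow_const _ _ (Or.inr (by linarith))
      have h2 : ContinuousAt (fun t : ℝ => (T - t) ^ (2 * τ - 1)) T :=
        ContinuousAt.rpow_const (by fun_prop) (Or.inr (by linarith))
      simp only [F]
      fun_prop
    have h0 : F T = 0 := by
      simp [F, Real.zero_rpow (show 2 * τ - 1 ≠ 0 by linarith)]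
    have := hc.tendsto
    rw [h0] at this
    exact this.mono_left nhdsWithin_le_nhds
  rw [tendsto_iff_norm_sub_tendsto_zero]
  refine squeeze_zero' (Eventually.of_forall fun _ => norm_nonneg _) ?_ hF
  filter_upwards [Ioo_mem_nhdsLT hT] with t ht
  have htc : t ∈ Ioc 0 T := ⟨ht.1, ht.2.le⟩
  have m1 := memLp_halfKernel hτ htc
  have m2 := memLp_halfKernel hτ hTc
  have i1 : Integrable (fun s => halfKernel τ (t - s) • f s) (timeMeasure T) :=
    (Lp.memLp f).smul m1 |>.integrable (q := 1) le_rfl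
  have i2 : Integrable (fun s => halfKernel τ (T - s) • f s) (timeMeasure T) :=
    (Lp.memLp f).smul m2 |>.integrable (q := 1) le_rfl
  rw [rlIntLeft_eq_halfKernel htc, rlIntLeft_eq_halfKernel hTc, ← integral_sub i1 i2]
  simp only [← sub_smul]
  refine (norm_integral_smul_le (m1.sub m2) f).trans ?_
  exact mul_le_mul_of_nonneg_right (Real.sqrt_le_sqrt (integral_halfKernel_sub_sq_le hτ hτ1 ht))
    (norm_nonneg _)

variable [CompleteSpace H]

theorem rlIntLeft_end_eq_zero (hT : 0 < T) (hτ : 1 / 2 < τ) (hτ1 : τ < 1) {v : ℝ → H}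
    {V G : Lp H 2 (timeMeasure T)} (hV : V =ᵐ[timeMeasure T] v) (h : V = fracInt T τ G)
    (hv : ZeroAtEnd T v) : rlIntLeft τ G T = 0 := by
  have h1 := (tendsto_rlIntLeft_end hT hτ hτ1 G).mono_left
    (inf_le_left (b := ae (volume : Measure ℝ)))
  refine tendsto_nhds_unique (h1.congr' ?_) hv
  have h2 : ∀ᵐ t ∂(timeMeasure T), rlIntLeft τ G t = v t := by
    filter_upwards [hV, fracInt_ae_eq (T := T) (show 0 < τ by linarith) (f := G)
      EventuallyEq.rfl] with t e1 e2
    rw [← e2, ← e1, h]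
  exact (eventually_nhdsLT_inf_ae hT h2).mono fun t ht => ht.2

/-- Both functions have the same image (T-t)^τ c / Γ(τ+1) under the injective J*^1; τ > 1/2 puts the
kernel in L². -/
theorem eq_halfKernel_smul (hτ : 1 / 2 < τ) (hT : 0 < T) {k : Lp H 2 (timeMeasure T)} {c : H}
    (hk : fracIntRight T 1 k = fracIntRight T τ (Lp.const 2 (timeMeasure T) c)) :
    k =ᵐ[timeMeasure T] fun t => halfKernel τ (T - t) • c := by
  have hτ0 : 0 < τ := by linarith
  have hm : MemLp (fun t => halfKernel τ (T - t) • c) 2 (timeMeasure T) :=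
    (memLp_halfKernel hτ ⟨hT, le_rfl⟩).of_le_mul (c := ‖c‖)
      ((memLp_halfKernel hτ ⟨hT, le_rfl⟩).1.smul_const c)
      (Eventually.of_forall fun t => by rw [norm_smul, mul_comm])
  have : k = hm.toLp _ := by
    rw [← sub_eq_zero]
    refine fracIntRight_one_injective ?_
    rw [map_sub, hk, sub_eq_zero]
    refine Lp.ext ?_
    filter_upwards [fracIntRight_const hτ0 c, fracIntRight_ae_eq one_pos hm.coeFn_toLp,
      ae_mem_timeMeasure T] with t h1 h2 ht
    rw [h1, h2, rlIntRight]
    simp only [Real.Gamma_one, inv_one, sub_self, Real.rpow_zero, one_smul]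
    rw [intervalIntegral.integral_smul_const]
    congr 1
    rw [intervalIntegral.integral_comp_sub_left (halfKernel τ) T, sub_self,
      intervalIntegral.integral_of_le (by linarith [ht.2])]
    have : ∀ x ∈ Ioc 0 (T - t), halfKernel τ x = (Real.Gamma τ)⁻¹ * x ^ (τ - 1) := fun x hx =>
      indicator_of_mem (mem_Ioi.mpr hx.1) _
    rw [setIntegral_congr_fun measurableSet_Ioc this,
      ← intervalIntegral.integral_of_le (by linarith [ht.2]), intervalIntegral.integral_const_mul,
      integral_rpow (Or.inl (by linarith)), Real.Gamma_add_one hτ0.ne', sub_add_cancel,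
      Real.zero_rpow hτ0.ne', sub_zero]
    field_simp
  rw [this]
  exact hm.coeFn_toLp

/-- Near T the left side is O((T-t)^{1/2}), while the right side is (T-t)^τ c / Γ(τ+1), which is
larger unless c = 0. -/
theorem const_eq_zero_of_fracIntRight_eq (hT : 0 < T) (h0 : 0 < τ) (hτ : τ < 1 / 2)
    {k : Lp H 2 (timeMeasure T)} {c : H}
    (hk : fracIntRight T 1 k = fracIntRight T τ (Lp.const 2 (timeMeasure T) c)) : c = 0 := by
  have hΓ := Real.Gamma_pos_of_pos (show 0 < τ + 1 by linarith)
  let F : ℝ → ℝ := fun t => (T - t) ^ (1 / 2 - τ) * ‖k‖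
  have hev : ∀ᵐ t ∂(timeMeasure T), t ∈ Ioo 0 T → ‖c‖ / Real.Gamma (τ + 1) ≤ F t := by
    filter_upwards [fracIntRight_const h0 c, norm_fracIntRight_one_le k] with t h1 h2 ht
    rw [hk, h1, norm_smul] at h2
    have hpos : 0 < T - t := by linarith [ht.2]
    have hp : 0 < (T - t) ^ τ := Real.rpow_pos_of_pos hpos _
    rw [Real.norm_of_nonneg (by positivity), Real.sqrt_eq_rpow,
      show (1 / 2 : ℝ) = 1 / 2 - τ + τ by ring, Real.rpow_add hpos] at h2
    refine le_of_mul_le_mul_right ?_ hp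
    calc _ = (T - t) ^ τ / Real.Gamma (τ + 1) * ‖c‖ := by ring
      _ ≤ _ := h2
      _ = _ := by simp only [F]; ring
  have hF : Tendsto F (𝓝[<] T ⊓ ae volume) (𝓝 0) := by
    have hc : ContinuousAt F T := by
      have h2 : ContinuousAt (fun t : ℝ => (T - t) ^ (1 / 2 - τ)) T :=
        ContinuousAt.rpow_const (by fun_prop) (Or.inr (by linarith))
      simp only [F]
      fun_prop
    have h00 : F T = 0 := by
      have : 1 / 2 - τ ≠ 0 := by linarith
      simp only [F, sub_self, Real.zero_rpow this, zero_mul]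
    have := hc.tendsto
    rw [h00] at this
    exact this.mono_left (inf_le_left.trans nhdsWithin_le_nhds)
  have hle := ge_of_tendsto hF
    ((eventually_nhdsLT_inf_ae hT hev).mono fun t ht => ht.2 ht.1)
  have : ‖c‖ / Real.Gamma (τ + 1) * Real.Gamma (τ + 1) ≤ 0 * Real.Gamma (τ + 1) :=
    mul_le_mul_of_nonneg_right hle hΓ.le
  rw [div_mul_cancel₀ _ hΓ.ne', zero_mul] at this
  exact norm_le_zero_iff.mp this

end EndValue

/-! ### Approximation by test functions -/

section Density

variable {H : Type*} [NormedAddCommGroup H] [InnerProductSpace ℝ H] [CompleteSpace H]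
variable {T τ : ℝ}

/-- The left derivatives of order `τ` of the test functions. -/
def testLeftD (T τ : ℝ) : Submodule ℝ (Lp H 2 (timeMeasure T)) where
  carrier := {x | ∃ (ψ : ℝ → H) (h : IsTest T ψ), h.leftD τ = x}
  add_mem' := by
    rintro _ _ ⟨ψ, h, rfl⟩ ⟨χ, h', rfl⟩
    exact ⟨_, h.add h', by rw [IsTest.leftD, h.deriv_toLp_add h', map_add]; rfl⟩
  zero_mem' := ⟨_, isTest_zero T, by rw [IsTest.leftD, isTest_zero_deriv_toLp, map_zero]⟩
  smul_mem' := by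
    rintro c _ ⟨ψ, h, rfl⟩
    exact ⟨_, h.const_smul c, by rw [IsTest.leftD, h.deriv_toLp_const_smul, map_smul]; rfl⟩

/-- The closure is the double orthogonal complement. A vector k in the complement has constant
J*^{1-τ} k: this makes k zero below order 1/2, and above it a multiple of the kernel that evaluates
J^τ G at T. -/
theorem mem_closure_testLeftD (hT : 0 < T) (h0 : 0 < τ) (h1 : τ < 1) (hτ : τ ≠ 1 / 2)
    {v : ℝ → H} {V G : Lp H 2 (timeMeasure T)} (hV : V =ᵐ[timeMeasure T] v)
    (h : V = fracInt T τ G) (hv : 1 / 2 < τ → ZeroAtEnd T v) :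
    G ∈ (testLeftD T τ).topologicalClosure := by
  rw [← Submodule.orthogonal_orthogonal_eq_closure, Submodule.mem_orthogonal]
  intro k hk
  rw [Submodule.mem_orthogonal] at hk
  obtain ⟨c, hc⟩ := exists_eq_const_of_inner_deriv_eq_zero hT
    (f := fracIntRight T (1 - τ) k) fun ψ hψ => by
      rw [← inner_fracInt_right, real_inner_comm]
      exact hk _ ⟨ψ, hψ, rfl⟩
  have hc1 : fracIntRight T 1 k = fracIntRight T τ (Lp.const 2 (timeMeasure T) c) := by
    rw [← hc, ← fracIntRight_add h0 (by linarith), add_sub_cancel]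
  rcases lt_or_gt_of_ne hτ with hτ | hτ
  · have hc0 := const_eq_zero_of_fracIntRight_eq hT h0 hτ hc1
    rw [hc0, map_zero, map_zero] at hc1
    rw [fracIntRight_one_injective hc1, inner_zero_left]
  · have hk2 := eq_halfKernel_smul hτ hT hc1
    have hi : Integrable (fun s => halfKernel τ (T - s) • G s) (timeMeasure T) :=
      (Lp.memLp G).smul (memLp_halfKernel hτ ⟨hT, le_rfl⟩) |>.integrable (q := 1) le_rfl
    have : inner ℝ k G = inner ℝ c (rlIntLeft τ G T) := by
      rw [rlIntLeft_eq_halfKernel ⟨hT, le_rfl⟩, ← integral_inner hi, L2.inner_def]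
      refine integral_congr_ae ?_
      filter_upwards [hk2] with t ht
      rw [ht, inner_smul_left, inner_smul_right]
      rfl
    rw [this, rlIntLeft_end_eq_zero hT hτ h1 hV h (hv hτ), inner_zero_right]

theorem abs_cos_pi_mul_pos (h0 : 0 < τ) (h1 : τ < 1) (hτ : τ ≠ 1 / 2) :
    0 < |Real.cos (Real.pi * τ)| := by
  rw [abs_pos]
  intro h
  rw [Real.cos_eq_zero_iff] at h
  obtain ⟨n, hn⟩ := h
  have h2 : τ = (2 * n + 1) / 2 := by
    have := Real.pi_pos
    field_simp at hn ⊢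
    linarith
  have h3 : (-1 : ℝ) < n := by linarith
  have h4 : (n : ℝ) < 1 := by linarith
  have h5 : n = 0 := by
    have h3' : (-1 : ℤ) < n := by exact_mod_cast h3
    have h4' : n < (1 : ℤ) := by exact_mod_cast h4
    omega
  rw [h5] at h2
  apply hτ
  rw [h2]
  norm_num

/-- Along test functions whose left derivatives tend to G, the comparison makes the right
derivatives Cauchy. Applying J^τ and J*^τ to the two sequences gives back the same test functions,
so the limits satisfy J*^τ ρ = J^τ G. -/
theorem exists_rightD_limit (h0 : 0 < τ) (h1 : τ < 1) (hτ : τ ≠ 1 / 2)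
    {G : Lp H 2 (timeMeasure T)} (hG : G ∈ (testLeftD T τ).topologicalClosure) :
    ∃ ρ : Lp H 2 (timeMeasure T), fracIntRight T τ ρ = fracInt T τ G ∧
      ∀ ψ (hψ : IsTest T ψ), |Real.cos (Real.pi * τ)| * ‖hψ.rightD τ - ρ‖ ≤ ‖hψ.leftD τ - G‖ := by
  have hcos := abs_cos_pi_mul_pos h0 h1 hτ
  obtain ⟨x, hx, hlim⟩ := mem_closure_iff_seq_limit.mp hG
  choose χ hχ hχx using hx
  have hlim' : Tendsto (fun n => (hχ n).leftD τ) atTop (𝓝 G) := by simpa only [hχx] using hlim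
  have hcauchy : CauchySeq fun n => (hχ n).rightD τ := by
    rw [Metric.cauchySeq_iff]
    intro ε hε
    obtain ⟨N, hN⟩ := Metric.cauchySeq_iff.mp hlim'.cauchySeq
      (|Real.cos (Real.pi * τ)| * ε) (by positivity)
    refine ⟨N, fun m hm n hn => ?_⟩
    have h2 := hN m hm n hn
    rw [dist_eq_norm, ← (hχ m).leftD_sub (hχ n)] at h2
    rw [dist_eq_norm, ← (hχ m).rightD_sub (hχ n)]
    exact lt_of_mul_lt_mul_left
      (((hχ m).sub (hχ n)).norm_rightD_le h0 h1 hτ |>.trans_lt h2) hcos.le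
  obtain ⟨ρ, hρ⟩ := cauchySeq_tendsto_of_complete hcauchy
  refine ⟨ρ, ?_, fun ψ hψ => ?_⟩
  · refine tendsto_nhds_unique (((fracIntRight T τ).continuous.tendsto ρ).comp hρ) ?_
    refine (((fracInt T τ).continuous.tendsto G).comp hlim').congr fun n => ?_
    simp only [Function.comp_apply]
    rw [(hχ n).fracInt_leftD h0 h1, (hχ n).fracIntRight_rightD h0 h1]
  · refine le_of_tendsto_of_tendsto (((tendsto_const_nhds.sub hρ).norm).const_mul _)
      ((tendsto_const_nhds.sub hlim').norm) (Eventually.of_forall fun n => ?_)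
    simp only
    rw [← hψ.rightD_sub (hχ n), ← hψ.leftD_sub (hχ n)]
    exact (hψ.sub (hχ n)).norm_rightD_le h0 h1 hτ

end Density

/-! ### The pairing as a limit over test functions -/

section Pairing

variable {H : Type*} [NormedAddCommGroup H] [InnerProductSpace ℝ H] [CompleteSpace H]
variable {T τ : ℝ}

theorem IsTest.leftDist_eq (h0 : 0 < τ) (h1 : τ < 1) {ψ v : ℝ → H} (hψ : IsTest T ψ)
    {V K : Lp H 2 (timeMeasure T)} (hV : V =ᵐ[timeMeasure T] v)
    (hK : K =ᵐ[timeMeasure T] leftDeriv T τ v) :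
    leftDist T τ ψ v =
      (‖hψ.toLp - V‖ₑ ^ 2 + ‖hψ.leftD τ - K‖ₑ ^ 2) ^ (1 / 2 : ℝ) := by
  rw [leftDist, Lp.enorm_def, Lp.enorm_def]
  congr 3
  · refine eLpNorm_congr_ae ?_
    filter_upwards [Lp.coeFn_sub hψ.toLp V, hψ.toLp_ae_eq, hV] with t e1 e2 e3
    rw [e1, Pi.sub_apply, Pi.sub_apply, e2, e3]
  · refine eLpNorm_congr_ae ?_
    filter_upwards [Lp.coeFn_sub (hψ.leftD τ) K, hψ.leftDeriv_ae_eq h0 h1, hK] with t e1 e2 e3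
    rw [e1, Pi.sub_apply, Pi.sub_apply, e2, e3]

theorem tendsto_testNhds (h0 : 0 < τ) (h1 : τ < 1) {v : ℝ → H}
    {V K : Lp H 2 (timeMeasure T)} (hV : V =ᵐ[timeMeasure T] v)
    (hK : K =ᵐ[timeMeasure T] leftDeriv T τ v) {F : (ℝ → H) → ℝ} {ℓ C : ℝ}
    (hF : ∀ ψ (hψ : IsTest T ψ), |F ψ - ℓ| ≤ C * (‖hψ.toLp - V‖ + ‖hψ.leftD τ - K‖)) :
    Tendsto F (testNhds T τ v) (𝓝 ℓ) := by
  have hd : Tendsto (fun ψ => leftDist T τ ψ v) (testNhds T τ v) (𝓝 0) :=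
    tendsto_comap.mono_left inf_le_left
  have hle (a b : ENNReal) : a ≤ (a ^ 2 + b ^ 2) ^ (1 / 2 : ℝ) := by
    calc a = (a ^ 2) ^ (1 / 2 : ℝ) := by
          rw [← ENNReal.rpow_natCast, ← ENNReal.rpow_mul]; norm_num
      _ ≤ _ := ENNReal.rpow_le_rpow le_self_add (by norm_num)
  rw [tendsto_iff_edist_tendsto_0]
  have hlim : Tendsto (fun ψ => ENNReal.ofReal C * (leftDist T τ ψ v + leftDist T τ ψ v))
      (testNhds T τ v) (𝓝 0) := by
    have := ENNReal.Tendsto.const_mul (a := ENNReal.ofReal C) (hd.add hd)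
      (Or.inr ENNReal.ofReal_ne_top)
    simpa using this
  refine tendsto_of_tendsto_of_tendsto_of_le_of_le' tendsto_const_nhds hlim
    (Eventually.of_forall fun _ => zero_le) ?_
  have ht : ∀ᶠ ψ in testNhds T τ v, IsTest T ψ := mem_inf_of_right (mem_principal_self _)
  filter_upwards [ht] with ψ hψ
  have e1 : ‖hψ.toLp - V‖ₑ ≤ leftDist T τ ψ v := by
    rw [hψ.leftDist_eq h0 h1 hV hK]; exact hle _ _
  have e2 : ‖hψ.leftD τ - K‖ₑ ≤ leftDist T τ ψ v := by
    rw [hψ.leftDist_eq h0 h1 hV hK, add_comm]; exact hle _ _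
  calc edist (F ψ) ℓ = ENNReal.ofReal |F ψ - ℓ| := by rw [edist_dist, Real.dist_eq]
    _ ≤ ENNReal.ofReal (C * (‖hψ.toLp - V‖ + ‖hψ.leftD τ - K‖)) := ENNReal.ofReal_le_ofReal (hF ψ hψ)
    _ = ENNReal.ofReal C * (‖hψ.toLp - V‖ₑ + ‖hψ.leftD τ - K‖ₑ) := by
        rw [ENNReal.ofReal_mul' (by positivity), ENNReal.ofReal_add (norm_nonneg _) (norm_nonneg _),
          ofReal_norm, ofReal_norm]
    _ ≤ _ := by gcongr

theorem neBot_testNhds (h0 : 0 < τ) (h1 : τ < 1) {v : ℝ → H}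
    {V K : Lp H 2 (timeMeasure T)} (hV : V =ᵐ[timeMeasure T] v)
    (hK : K =ᵐ[timeMeasure T] leftDeriv T τ v) (h : V = fracInt T τ K)
    (hcl : K ∈ (testLeftD T τ).topologicalClosure) : (testNhds T τ v).NeBot := by
  obtain ⟨x, hx, hlim⟩ := mem_closure_iff_seq_limit.mp hcl
  choose χ hχ hχx using hx
  have hlim' : Tendsto (fun n => (hχ n).leftD τ) atTop (𝓝 K) := by simpa only [hχx] using hlim
  have hlim2 : Tendsto (fun n => (hχ n).toLp) atTop (𝓝 V) := by
    rw [h]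
    refine (((fracInt T τ).continuous.tendsto K).comp hlim').congr fun n => ?_
    exact (hχ n).fracInt_leftD h0 h1
  have htend : Tendsto χ atTop (testNhds T τ v) := by
    refine tendsto_inf.mpr ⟨tendsto_comap_iff.mpr ?_,
      tendsto_principal.mpr (Eventually.of_forall hχ)⟩
    have e1 : Tendsto (fun n => ‖(hχ n).toLp - V‖ₑ) atTop (𝓝 0) := by
      simpa [edist_eq_enorm_sub] using tendsto_iff_edist_tendsto_0.mp hlim2
    have e2 : Tendsto (fun n => ‖(hχ n).leftD τ - K‖ₑ) atTop (𝓝 0) := by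
      simpa [edist_eq_enorm_sub] using tendsto_iff_edist_tendsto_0.mp hlim'
    have e3 := (((ENNReal.continuous_pow 2).tendsto 0).comp e1).add
      (((ENNReal.continuous_pow 2).tendsto 0).comp e2)
    have e4 := ((ENNReal.continuous_rpow_const (y := (1 / 2 : ℝ))).tendsto _).comp e3
    have e5 : ((0 : ENNReal) ^ 2 + 0 ^ 2) ^ (1 / 2 : ℝ) = 0 := by
      norm_num
    rw [e5] at e4
    refine e4.congr fun n => ?_
    simp only [Function.comp_apply]
    exact ((hχ n).leftDist_eq h0 h1 hV hK).symm
  exact htend.neBot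

omit [CompleteSpace H] in
theorem dualPairing_eq {u v : ℝ → H} {ℓ : ℝ}
    (h : HasDualPairing T τ (rlDistLeft T (2 * τ) u) v ℓ) : dualPairing T τ u v = ℓ := by
  have h' : ∃ ℓ, HasDualPairing T τ (rlDistLeft T (2 * τ) u) v ℓ := ⟨ℓ, h⟩
  rw [dualPairing, dif_pos h']
  have := h.2.1
  exact tendsto_nhds_unique h'.choose_spec.2.2 h.2.2

theorem exists_dualPairing (h0 : 0 < τ) (h1 : τ < 1) (hτ : τ ≠ 1 / 2) {u v : ℝ → H}
    {U G V K : Lp H 2 (timeMeasure T)} (hU : U =ᵐ[timeMeasure T] u) (hUG : U = fracInt T τ G)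
    (hV : V =ᵐ[timeMeasure T] v) (hVK : V = fracInt T τ K)
    (hcl : K ∈ (testLeftD T τ).topologicalClosure) :
    ∃ ρ : Lp H 2 (timeMeasure T), V = fracIntRight T τ ρ ∧
      |Real.cos (Real.pi * τ)| * ‖ρ‖ ≤ ‖K‖ ∧
      HasDualPairing T τ (rlDistLeft T (2 * τ) u) v (inner ℝ G ρ) ∧
      ∀ f, HasLeftDeriv T (2 * τ) u f → inner ℝ G ρ = ip T f v := by
  have hcos := abs_cos_pi_mul_pos h0 h1 hτ
  obtain ⟨ρ, hρ, hb⟩ := exists_rightD_limit h0 h1 hτ hcl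
  have hder := hasLeftDeriv_of_eq_fracInt h0 h1 hV (G := K) EventuallyEq.rfl hVK
  have hK := (hder.ae_eq (hasLeftDeriv_leftDeriv hder))
  have := neBot_testNhds h0 h1 hV hK hVK hcl
  have hlim : Tendsto (rlDistLeft T (2 * τ) u) (testNhds T τ v) (𝓝 (inner ℝ G ρ)) := by
    refine tendsto_testNhds h0 h1 hV hK (C := ‖G‖ * |Real.cos (Real.pi * τ)|⁻¹) fun ψ hψ => ?_
    rw [rlDistLeft_two_mul h0 h1 hτ hU hUG hψ, ← inner_sub_right]
    have h2 : ‖hψ.rightD τ - ρ‖ ≤ |Real.cos (Real.pi * τ)|⁻¹ * ‖hψ.leftD τ - K‖ := by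
      rw [inv_mul_eq_div, le_div_iff₀ hcos, mul_comm]
      exact hb ψ hψ
    calc _ ≤ ‖G‖ * ‖hψ.rightD τ - ρ‖ := abs_real_inner_le_norm _ _
      _ ≤ ‖G‖ * (|Real.cos (Real.pi * τ)|⁻¹ * ‖hψ.leftD τ - K‖) := by gcongr
      _ ≤ ‖G‖ * (|Real.cos (Real.pi * τ)|⁻¹ * (‖hψ.toLp - V‖ + ‖hψ.leftD τ - K‖)) := by
        gcongr
        exact le_add_of_nonneg_left (norm_nonneg _)
      _ = _ := by ring
  refine ⟨ρ, by rw [hρ, hVK], ?_, ⟨⟨_, hder⟩, inferInstance, hlim⟩, fun f hf => ?_⟩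
  -- The zero test function turns the difference estimate into the norm bound for ρ.
  · have := hb _ (isTest_zero T)
    rw [IsTest.rightD, IsTest.leftD, isTest_zero_deriv_toLp, map_zero, map_zero, neg_zero, zero_sub,
      zero_sub, norm_neg, norm_neg] at this
    exact this
  -- When the derivative of order 2τ is in L², the same functional is ψ ↦ (f, ψ), which is
  -- continuous in L² alone.
  · refine tendsto_nhds_unique hlim (tendsto_testNhds h0 h1 hV hK (C := ‖hf.1.toLp f‖)
      fun ψ hψ => ?_)
    rw [← hf.2 ψ hψ, ip_eq_inner hf.1.coeFn_toLp hψ.toLp_ae_eq, ip_eq_inner hf.1.coeFn_toLp hV,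
      ← inner_sub_right]
    refine (abs_real_inner_le_norm _ _).trans ?_
    gcongr
    exact le_add_of_nonneg_right (norm_nonneg _)

end Pairing

/-! ### From weak measurability to measurability of inner products -/

section Measurability

variable {H : Type*} [NormedAddCommGroup H] [InnerProductSpace ℝ H] [CompleteSpace H]
variable {T : ℝ} {ν : Measure ℝ}

/-- The admissible x form a subspace closed under sequential limits, and the test functions in it
already have trivial orthogonal complement. -/
theorem aemeasurable_inner_of_isTest {X : ℝ → Lp H 2 (timeMeasure T)}
    (hX : ∀ ψ (hψ : IsTest T ψ), AEMeasurable (fun τ => (inner ℝ (X τ) hψ.toLp : ℝ)) ν)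
    (x : Lp H 2 (timeMeasure T)) : AEMeasurable (fun τ => (inner ℝ (X τ) x : ℝ)) ν := by
  let M : Submodule ℝ (Lp H 2 (timeMeasure T)) :=
    { carrier := {x | AEMeasurable (fun τ => (inner ℝ (X τ) x : ℝ)) ν}
      add_mem' := fun {a b} ha hb => by
        simp only [mem_ofPred_eq, inner_add_right]
        exact ha.add hb
      zero_mem' := by simp
      smul_mem' := fun c a ha => by
        simp only [mem_ofPred_eq, inner_smul_right]
        exact ha.const_mul c }
  have hM : M.topologicalClosure = ⊤ := by
    rw [Submodule.topologicalClosure_eq_top_iff, Submodule.eq_bot_iff]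
    intro f hf
    refine eq_of_ip_isTest_eq fun ψ hψ => ?_
    rw [inner_zero_left, real_inner_comm]
    exact (Submodule.mem_orthogonal _ _).mp hf _ (hX ψ hψ)
  have hx : x ∈ M.topologicalClosure := hM ▸ Submodule.mem_top
  obtain ⟨y, hy, hlim⟩ := mem_closure_iff_seq_limit.mp hx
  exact aemeasurable_of_tendsto_metrizable_ae atTop hy
    (Eventually.of_forall fun τ => tendsto_const_nhds.inner hlim)

/-- Parseval's identity in a Hilbert basis. Its elements lie at mutual distance √2, so separability
makes the basis countable and the partial sums converge along a countably generated filter. -/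
theorem aemeasurable_inner_of_forall {E : Type*} [NormedAddCommGroup E] [InnerProductSpace ℝ E]
    [CompleteSpace E] [SecondCountableTopology E] {X Y : ℝ → E}
    (hX : ∀ x, AEMeasurable (fun τ => (inner ℝ (X τ) x : ℝ)) ν)
    (hY : ∀ x, AEMeasurable (fun τ => (inner ℝ (Y τ) x : ℝ)) ν) :
    AEMeasurable (fun τ => (inner ℝ (X τ) (Y τ) : ℝ)) ν := by
  obtain ⟨w, b, hb⟩ := exists_hilbertBasis ℝ E
  have : DiscreteTopology w := by
    refine DiscreteTopology.of_forall_le_dist one_pos fun i j hij => ?_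
    have ho := b.orthonormal
    rw [hb] at ho
    have h2 : ‖(i : E) - j‖ ^ 2 = 2 := by
      rw [norm_sub_sq_real, ho.1 i, ho.1 j, ho.2 hij]
      norm_num
    change 1 ≤ dist i j
    rw [Subtype.dist_eq, dist_eq_norm]
    nlinarith [norm_nonneg ((i : E) - j)]
  have : Countable w := countable_of_Lindelof_of_discrete
  have h (τ : ℝ) : HasSum (fun i => (inner ℝ (X τ) (b i) : ℝ) * inner ℝ (b i) (Y τ))
    (inner ℝ (X τ) (Y τ)) := b.hasSum_inner_mul_inner _ _
  refine aemeasurable_of_tendsto_metrizable_ae atTop (f := fun (s : Finset w) τ =>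
    ∑ i ∈ s, (inner ℝ (X τ) (b i) : ℝ) * inner ℝ (b i) (Y τ)) (fun s => ?_)
    (Eventually.of_forall fun τ => h τ)
  refine Finset.aemeasurable_fun_sum _ fun i _ => (hX _).mul ?_
  simp only [real_inner_comm]
  exact hY _

end Measurability

/-! ### Integration over the order -/

section Main

variable {H : Type*} [NormedAddCommGroup H] [InnerProductSpace ℝ H] [CompleteSpace H]
variable {T τmin τmax : ℝ} {φ : ℝ → ℝ}

/-- No singular part `c t ^ (τ - 1)` occurs in the distributed space: if the derivatives exist for
almost every order, then `u` is the fractional integral of its derivative. -/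
theorem ae_eq_fracInt (hT : 0 < T) (h0 : 0 < τmin) (h1 : τmax < 1)
    {u : ℝ → H} {U : Lp H 2 (timeMeasure T)} (hU : U =ᵐ[timeMeasure T] u)
    (hu : ∀ᵐ τ ∂(volume.restrict (Icc τmin τmax)), ∃ g, HasLeftDeriv T τ u g) :
    ∀ᵐ τ ∂(volume.restrict (Icc τmin τmax)), ∃ G : Lp H 2 (timeMeasure T),
      G =ᵐ[timeMeasure T] leftDeriv T τ u ∧ U = fracInt T τ G := by
  have hu' := (ae_restrict_iff' measurableSet_Icc).mp hu
  filter_upwards [hu, ae_restrict_mem measurableSet_Icc,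
    ae_restrict_of_ae (Measure.ae_ne volume τmax)] with τ hτ hmem hne
  have hlt : τ < τmax := lt_of_le_of_ne hmem.2 hne
  -- A larger order with a derivative exists because almost every point of (τ, τmax) qualifies; this
  -- is why the endpoint τmax is discarded.
  obtain ⟨σ, hσ, hσ'⟩ : ∃ σ, σ ∈ Ioo τ τmax ∧ ∃ g, HasLeftDeriv T σ u g := by
    have e1 : ∀ᶠ σ in 𝓝[>] τ, σ ∈ Ioo τ τmax := Ioo_mem_nhdsGT hlt
    obtain ⟨σ, h2, h3⟩ := ((e1.filter_mono (inf_le_left (b := ae (volume : Measure ℝ)))).and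
      (hu'.filter_mono inf_le_right)).exists
    exact ⟨σ, h2, h3 ⟨hmem.1.trans h2.1.le, h2.2.le⟩⟩
  obtain ⟨g, hg⟩ := hτ
  obtain ⟨g', hg'⟩ := hσ'
  have hd := hasLeftDeriv_leftDeriv hg
  have hτ0 : 0 < τ := h0.trans_le hmem.1
  have hτ1 : τ < 1 := hmem.2.trans_lt h1
  obtain ⟨c, hc⟩ := exists_fracInt_eq_add_const hT hτ0 hτ1 hU hd.1.coeFn_toLp hd
  obtain ⟨c', hc'⟩ := exists_fracInt_eq_add_const hT (hτ0.trans hσ.1) (hσ.2.trans h1) hU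
    hg'.1.coeFn_toLp hg'
  have k1 := fracInt_one_eq_add hτ0 hτ1 hc
  have k2 := fracInt_one_eq_add (hτ0.trans hσ.1) (hσ.2.trans h1) hc'
  have hc0 := const_eq_zero_of_two_orders hT hτ0 hσ.1 (k1.symm.trans k2)
  rw [hc0, map_zero, map_zero, add_zero] at k1
  exact ⟨_, hd.1.coeFn_toLp, eq_fracInt_of_fracInt_one_eq hτ0 k1⟩

open Classical in
/-- The class of `f` in `L²(I; H)`, or `0` if `f` is not square integrable. -/
def lpClass (T : ℝ) (f : ℝ → H) : Lp H 2 (timeMeasure T) :=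
  if h : MemLp f 2 (timeMeasure T) then h.toLp f else 0

omit [InnerProductSpace ℝ H] [CompleteSpace H] in
theorem lpClass_eq {f : ℝ → H} {F : Lp H 2 (timeMeasure T)} (h : F =ᵐ[timeMeasure T] f) :
    lpClass T f = F := by
  have hm : MemLp f 2 (timeMeasure T) := (memLp_congr_ae h).mp (Lp.memLp F)
  rw [lpClass, dif_pos hm]
  exact Lp.ext (hm.coeFn_toLp.trans h.symm)

omit [InnerProductSpace ℝ H] [CompleteSpace H] in
theorem lpClass_ae_eq {f : ℝ → H} {F : Lp H 2 (timeMeasure T)} (h : F =ᵐ[timeMeasure T] f) :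
    lpClass T f =ᵐ[timeMeasure T] f := by
  rw [lpClass_eq h]; exact h

/-- The right side depends on τ only through the operator, with U fixed, so the chosen derivatives
are weakly measurable in τ. -/
theorem inner_isTest_of_eq_fracInt {τ : ℝ} (h0 : 0 < τ) (h1 : τ < 1)
    {U G : Lp H 2 (timeMeasure T)} (h : U = fracInt T τ G) {ψ : ℝ → H} (hψ : IsTest T ψ) :
    inner ℝ G hψ.toLp = -inner ℝ (fracInt T (1 - τ) U) hψ.deriv.toLp := by
  rw [h, ← fracInt_add (by linarith) h0, sub_add_cancel, inner_fracInt_left,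
    fracIntRight_one_deriv hψ, inner_neg_right, neg_neg]

theorem inner_isTest_of_eq_fracIntRight {τ : ℝ} (h0 : 0 < τ) (h1 : τ < 1)
    {V R : Lp H 2 (timeMeasure T)} (h : V = fracIntRight T τ R) {ψ : ℝ → H} (hψ : IsTest T ψ) :
    inner ℝ R hψ.toLp = inner ℝ (fracInt T (1 - τ) hψ.deriv.toLp) V := by
  rw [real_inner_comm, h, inner_fracInt_left, ← fracIntRight_add (by linarith) h0, sub_add_cancel,
    ← inner_fracInt_left, fracInt_one_deriv hψ]

theorem exists_cos_lower_bound (hne : τmin < τmax)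
    (h : ∀ τ ∈ Icc τmin τmax, 0 < |Real.cos (Real.pi * τ)|) :
    ∃ m, 0 < m ∧ ∀ τ ∈ Icc τmin τmax, m ≤ |Real.cos (Real.pi * τ)| := by
  obtain ⟨x, hx, hmin⟩ := isCompact_Icc.exists_isMinOn (nonempty_Icc.mpr hne.le)
    (f := fun τ => |Real.cos (Real.pi * τ)|) (by fun_prop)
  exact ⟨_, h x hx, fun τ hτ => hmin hτ⟩

omit [CompleteSpace H] in
theorem integral_norm_sq_eq {f : ℝ → H} {F : Lp H 2 (timeMeasure T)}
    (h : F =ᵐ[timeMeasure T] f) : ∫ t, ‖f t‖ ^ 2 ∂(timeMeasure T) = ‖F‖ ^ 2 := by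
  rw [← real_inner_self_eq_norm_sq F, ← ip_eq_inner h h]
  simp [ip]

theorem integrationByParts [SecondCountableTopology H] (hT : 0 < T) (h0 : 0 < τmin)
    (hlt : τmin < τmax) (h1 : τmax < 1) (hhalf : τmax < 1 / 2 ∨ 1 / 2 < τmin)
    (hφ : IntegrableOn φ (Icc τmin τmax)) (hφpos : ∀ τ ∈ Icc τmin τmax, 0 < φ τ)
    {u v : ℝ → H} (hu : MemLeftDistributed T τmin τmax φ u)
    (hv : MemLeftDistributed T τmin τmax φ v) (hend : 1 / 2 < τmin → ZeroAtEnd T v) :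
    IntegrationByParts T τmin τmax φ u v := by
  have hτ (τ : ℝ) (h : τ ∈ Icc τmin τmax) : 0 < τ ∧ τ < 1 ∧ τ ≠ 1 / 2 ∧
      (1 / 2 < τ → ZeroAtEnd T v) := by
    refine ⟨h0.trans_le h.1, h.2.trans_lt h1, ?_, fun h' => ?_⟩
    · rcases hhalf with h2 | h2
      · exact (h.2.trans_lt h2).ne
      · exact (h2.trans_le h.1).ne'
    · rcases hhalf with h2 | h2
      · exact absurd (h.2.trans_lt h2) h'.not_gt
      · exact hend h2
  set ν := volume.restrict (Icc τmin τmax) with hν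
  set U := hu.1.toLp u
  set V := hv.1.toLp v
  have hU : U =ᵐ[timeMeasure T] u := hu.1.coeFn_toLp
  have hV : V =ᵐ[timeMeasure T] v := hv.1.coeFn_toLp
  set X : ℝ → Lp H 2 (timeMeasure T) := fun τ => lpClass T (leftDeriv T τ u)
  set Y : ℝ → Lp H 2 (timeMeasure T) := fun τ => lpClass T (leftDeriv T τ v)
  set R : ℝ → Lp H 2 (timeMeasure T) := fun τ => lpClass T (rightDeriv T τ v)
  have hX : ∀ᵐ τ ∂ν, X τ =ᵐ[timeMeasure T] leftDeriv T τ u ∧ U = fracInt T τ (X τ) := by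
    filter_upwards [ae_eq_fracInt hT h0 h1 hU hu.2.1] with τ ⟨G, hG, hUG⟩
    exact ⟨lpClass_ae_eq hG, by simp only [X, lpClass_eq hG]; exact hUG⟩
  have hY : ∀ᵐ τ ∂ν, Y τ =ᵐ[timeMeasure T] leftDeriv T τ v ∧ V = fracInt T τ (Y τ) := by
    filter_upwards [ae_eq_fracInt hT h0 h1 hV hv.2.1] with τ ⟨G, hG, hUG⟩
    exact ⟨lpClass_ae_eq hG, by simp only [Y, lpClass_eq hG]; exact hUG⟩
  have hR : ∀ᵐ τ ∂ν, HasRightDeriv T τ v (R τ) ∧ R τ =ᵐ[timeMeasure T] rightDeriv T τ v ∧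
      V = fracIntRight T τ (R τ) ∧ |Real.cos (Real.pi * τ)| * ‖R τ‖ ≤ ‖Y τ‖ ∧
      HasDualPairing T τ (rlDistLeft T (2 * τ) u) v (inner ℝ (X τ) (R τ)) ∧
      ∀ f, HasLeftDeriv T (2 * τ) u f → inner ℝ (X τ) (R τ) = ip T f v := by
    filter_upwards [hX, hY, ae_restrict_mem measurableSet_Icc] with τ hx hy hm
    obtain ⟨t0, t1, tn, tz⟩ := hτ τ hm
    obtain ⟨ρ, k1, k2, k3, k4⟩ := exists_dualPairing t0 t1 tn hU hx.2 hV hy.2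
      (mem_closure_testLeftD hT t0 t1 tn hV hy.2 tz)
    have hr := hasRightDeriv_of_eq_fracIntRight t0 t1 hV (G := ρ) EventuallyEq.rfl k1
    have hr2 := hr.ae_eq (hasRightDeriv_rightDeriv hr)
    have hRρ : R τ = ρ := lpClass_eq hr2
    rw [hRρ]
    exact ⟨hr, hr2, k1, k2, k3, k4⟩
  have hdual : (fun τ => φ τ * dualPairing T τ u v) =ᵐ[ν] fun τ => φ τ * inner ℝ (X τ) (R τ) := by
    filter_upwards [hR] with τ hr
    rw [dualPairing_eq hr.2.2.2.2.1]
  have hip : (fun τ => φ τ * ip T (leftDeriv T τ u) (rightDeriv T τ v)) =ᵐ[ν]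
      fun τ => φ τ * inner ℝ (X τ) (R τ) := by
    filter_upwards [hX, hR] with τ hx hr
    rw [ip_eq_inner hx.1 hr.2.1]
  have hXm : ∀ x, AEMeasurable (fun τ => (inner ℝ (X τ) x : ℝ)) ν := by
    refine aemeasurable_inner_of_isTest fun ψ hψ => ?_
    refine (measurable_inner_fracInt h1 U hψ.deriv.toLp).neg.congr ?_
    filter_upwards [hX, ae_restrict_mem measurableSet_Icc] with τ hx hm
    rw [inner_isTest_of_eq_fracInt (hτ τ hm).1 (hτ τ hm).2.1 hx.2 hψ]
    rfl
  have hRm : ∀ x, AEMeasurable (fun τ => (inner ℝ (R τ) x : ℝ)) ν := by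
    refine aemeasurable_inner_of_isTest fun ψ hψ => ?_
    refine (measurable_inner_fracInt h1 hψ.deriv.toLp V).congr ?_
    filter_upwards [hR, ae_restrict_mem measurableSet_Icc] with τ hr hm
    rw [inner_isTest_of_eq_fracIntRight (hτ τ hm).1 (hτ τ hm).2.1 hr.2.2.1 hψ]
  obtain ⟨m, hm0, hm⟩ := exists_cos_lower_bound hlt fun τ h =>
    abs_cos_pi_mul_pos (hτ τ h).1 (hτ τ h).2.1 (hτ τ h).2.2.1
  have hint : Integrable (fun τ => φ τ * inner ℝ (X τ) (R τ)) ν := by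
    -- Separability of L²(I; H), needed for the countable Hilbert basis, is inferred from a finite
    -- exponent.
    have : Fact ((2 : ENNReal) ≠ ⊤) := ⟨ENNReal.ofNat_ne_top⟩
    refine ((hu.2.2.add hv.2.2).const_mul m⁻¹).mono' (hφ.1.mul
      (aemeasurable_inner_of_forall hXm hRm).aestronglyMeasurable) ?_
    filter_upwards [hX, hY, hR, ae_restrict_mem measurableSet_Icc] with τ hx hy hr hmem
    have hφτ := hφpos τ hmem
    simp only [Pi.add_apply]
    rw [integral_norm_sq_eq hx.1, integral_norm_sq_eq hy.1, norm_mul, Real.norm_of_nonneg hφτ.le]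
    have e1 : m * ‖R τ‖ ≤ ‖Y τ‖ :=
      (mul_le_mul_of_nonneg_right (hm τ hmem) (norm_nonneg _)).trans hr.2.2.2.1
    have e2 : ‖R τ‖ ≤ m⁻¹ * ‖Y τ‖ := by
      rw [inv_mul_eq_div, le_div_iff₀ hm0, mul_comm]
      exact e1
    calc φ τ * ‖(inner ℝ (X τ) (R τ) : ℝ)‖ ≤ φ τ * (‖X τ‖ * ‖R τ‖) := by
          gcongr
          exact norm_inner_le_norm _ _
      _ ≤ φ τ * (‖X τ‖ * (m⁻¹ * ‖Y τ‖)) := by gcongr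
      _ = m⁻¹ * (φ τ * (‖X τ‖ * ‖Y τ‖)) := by ring
      _ ≤ m⁻¹ * (φ τ * (‖X τ‖ ^ 2 + ‖Y τ‖ ^ 2)) := by
          gcongr
          nlinarith [sq_nonneg (‖X τ‖ - ‖Y τ‖), sq_nonneg (‖X τ‖), sq_nonneg (‖Y τ‖)]
      _ = _ := by ring
  refine ⟨?_, hint.congr hdual.symm, hint.congr hip.symm, integral_congr_ae (hdual.trans hip.symm)⟩
  filter_upwards [hR] with τ hr
  exact ⟨⟨_, hr.2.2.2.2.1⟩, fun f hf => by
    rw [dualPairing_eq hr.2.2.2.2.1, hr.2.2.2.2.2 f hf], ⟨_, hr.1⟩⟩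

end Main

end FracSobolev

end

theorem lemma3p5 (T : ℝ) (hT : 0 < T) (τmin τmax : ℝ)
    (hτ : (0 < 2 * τmin ∧ 2 * τmin < 2 * τmax ∧ 2 * τmax < 1) ∨
      (1 < 2 * τmin ∧ 2 * τmin < 2 * τmax ∧ 2 * τmax < 2))
    (φ : ℝ → ℝ) (hφ : IntegrableOn φ (Icc τmin τmax)) (hφpos : ∀ τ ∈ Icc τmin τmax, 0 < φ τ) :
    -- on `I`
    (∀ u v : ℝ → ℝ,
      FracSobolev.MemLeftDistributed T τmin τmax φ u →
      FracSobolev.MemLeftDistributed T τmin τmax φ v →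
      (1 < 2 * τmin → FracSobolev.ZeroAtEnd T v) →
      FracSobolev.IntegrationByParts T τmin τmax φ u v) ∧
    -- on `Ω = I × Λ_d`
    (∀ (d : ℕ) (a b : Fin d → ℝ), (∀ i, a i < b i) →
      ∀ u v : ℝ → FracSobolev.L2Box a b,
      FracSobolev.MemLeftDistributed T τmin τmax φ u →
      FracSobolev.MemLeftDistributed T τmin τmax φ v →
      (1 < 2 * τmin → FracSobolev.ZeroAtEnd T v) →
      FracSobolev.IntegrationByParts T τmin τmax φ u v) := by
  have h0 : 0 < τmin := by rcases hτ with h | h <;> linarith [h.1]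
  have hlt : τmin < τmax := by rcases hτ with h | h <;> linarith [h.2.1]
  have h1 : τmax < 1 := by rcases hτ with h | h <;> linarith [h.2.2]
  have hhalf : τmax < 1 / 2 ∨ 1 / 2 < τmin := by
    rcases hτ with h | h
    · left; linarith [h.2.2]
    · right; linarith [h.1]
  -- Makes L²(Λ_d) second countable, as the case H = L²(Λ_d) requires.
  have : Fact ((2 : ENNReal) ≠ ⊤) := ⟨ENNReal.ofNat_ne_top⟩
  exact ⟨fun u v hu hv hend => FracSobolev.integrationByParts hT h0 hlt h1 hhalf hφ hφpos hu hv
      fun h => hend (by linarith),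
    fun d a b _ u v hu hv hend => FracSobolev.integrationByParts hT h0 hlt h1 hhalf hφ hφpos hu hv
      fun h => hend (by linarith)⟩
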